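/- A Steiner quadruple system SQS$(n)$ is a pair $(X,\mathcal B)$ where $X$ is an $n$-element set and $\mathcal B$ is a collection of $4$-element subsets of $X$ (blocks) such that any three points of $X$ lie in exactly one block. A $1$-ocycle for $(X,\mathcal B)$ is a nonempty cyclic listing of strings, each listing the four points of a block in some order, in which every block is listed exactly once and the last letter of each string equals the first letter of its cyclic successor. Let $(X,\mathcal B)$ be an SQS$(n)$ with $n\equiv 2\pmod{12}$ that admits a $1$-ocycle. Then there exists an SQS$(3n-8)$ that admits a $1$-ocycle. More precisely, $n=12k+14$ for some integer $k\ge 0$, and Hanani's construction below can be carried out from $(X,\mathcal B)$ and always gives an SQS$(3n-8)$ that admits a $1$-ocycle. Construction. Label the points so that $X=\mathbb Z_{n-4}\cup\{A0,A1,A2,A3\}$ with $\{A0,A1,A2,A3\}\in\mathcal B$; such a labelling exists. Let $P_\alpha=P_\alpha(6k+5)$, $0\le\alpha\le 12k+8$, be systems of unordered pairs of distinct elements of $\mathbb Z_{n-4}=\mathbb Z_{12k+10}$ such that each $P_\alpha$ partitions $\mathbb Z_{n-4}$, each pair of distinct elements lies in exactly one $P_\alpha$, and $P_0\cup\dots\cup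 P_{4k+1}$ consists of the pairs whose difference is $\pm(2d+1)$ for some $0\le d\le 2k$; such systems exist. On the $3n-8$ points $(\{0,1,2\}\times\mathbb Z_{n-4})\cup\{A0,A1,A2,A3\}$, writing $ix$ for $(i,x)$, with the copy index $i$ taken modulo $3$ (in the products $i(4k+2)$ below, $i\in\{0,1,2\}$ is an integer), take the blocks 1. $\{A0,A1,A2,A3\}$; 2. $\{ix,iy,iz,it\}$ for $\{x,y,z,t\}\in\mathcal B$ other than $\{A0,A1,A2,A3\}$ (the prefix $i$ is omitted on points $Ah$); 3. $\{Aa_1,0a_2,1a_3,2a_4\}$ with $a_1\in\{0,1,2,3\}$ and $a_1+a_2+a_3+a_4\equiv 0\pmod{n-4}$; 4. $\{(i+2)b_3,\ i(b_1+2k+1+i(4k+2)-d),\ i(b_1+2k+2+i(4k+2)+d),\ (i+1)b_2\}$ with $b_1+b_2+b_3\equiv 0\pmod{n-4}$ and $0\le d\le 2k$; 5. $\{ir,is,(i+1)r',(i+1)s'\}$ with $[r,s],[r',s']\in P_\alpha$ (possibly the same pair) and $4k+2\le\alpha\le 12k+8$. -/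

import Mathlib

/-- `(X, B)` is a Steiner quadruple system of order `n`: the point set `X` has `n` elements, every
block has four points, and any three points lie in exactly one block. -/
def IsSQS {X : Type*} [Fintype X] (n : ℕ) (B : Set (Finset X)) : Prop :=
  Fintype.card X = n ∧
  (∀ b ∈ B, b.card = 4) ∧
  ∀ t : Finset X, t.card = 3 → ∃! b : Finset X, b ∈ B ∧ t ⊆ b

/-- An `s`-overlap cycle on the block set `B`: a nonempty cyclic listing `w 0, …, w (N - 1)` of
strings, each of which lists the points of a block in some order without repetition, such that
every block is listed exactly once and the last `s` letters of each string are the first `s`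
letters of its (cyclic) successor. -/
def IsOcycle {X : Type*} [DecidableEq X] (s : ℕ) (B : Set (Finset X)) (N : ℕ)
    (w : ZMod N → List X) : Prop :=
  0 < N ∧
  (∀ i, (w i).Nodup) ∧
  Set.BijOn (fun i => (w i).toFinset) Set.univ B ∧
  ∀ i, (w i).rtake s = (w (i + 1)).take s

/-- The block set `B` admits an `s`-overlap cycle. -/
def AdmitsOcycle {X : Type*} [DecidableEq X] (s : ℕ) (B : Set (Finset X)) : Prop :=
  ∃ (N : ℕ) (w : ZMod N → List X), IsOcycle s B N w

/-- The `12k + 14` points `{0, …, 12k + 9} ∪ {A0, A1, A2, A3}`, where the numbers are read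
modulo `12k + 10`. -/
abbrev OldPt (k : ℕ) : Type := ZMod (12 * k + 10) ⊕ Fin 4

/-- The points `({0, 1, 2} × {0, …, 12k + 9}) ∪ {A0, A1, A2, A3}`: three copies of the numbers and
one copy of the points `Ah`. -/
abbrev NewPt (k : ℕ) : Type := (ZMod 3 × ZMod (12 * k + 10)) ⊕ Fin 4

/-- The quadruple `{A0, A1, A2, A3}` of old points. -/
def oldA (k : ℕ) : Finset (OldPt k) := {.inr 0, .inr 1, .inr 2, .inr 3}

/-- The point `ix` of the `i`-th copy. -/
def copyPt {k : ℕ} (i : ZMod 3) (x : ZMod (12 * k + 10)) : NewPt k := .inl (i, x)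

/-- The point `Ah`. -/
def specialPt {k : ℕ} (h : Fin 4) : NewPt k := .inr h

/-- Prefix a number by `i`, and leave the points `Ah` unchanged. -/
def liftPt {k : ℕ} (i : ZMod 3) : OldPt k → NewPt k
  | .inl x => copyPt i x
  | .inr h => specialPt h

/-- Relabel the points of a block set along a bijection. -/
def relabel {X Y : Type*} (e : X ≃ Y) (B : Set (Finset X)) : Set (Finset Y) :=
  (fun b => b.map e.toEmbedding) '' B

/-- Systems of unordered pairs `P_α(6k + 5)`, `0 ≤ α ≤ 12k + 8`, on the integers modulo
`2 (6k + 5) = 12k + 10`: each `P_α` partitions the points into pairs, each pair of distinct points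
is in exactly one `P_α`, and the pairs in the first `4k + 2` systems are those whose difference is
one of `±1, ±3, …, ±(4k + 1)`. -/
structure IsPairSystem (k : ℕ) (P : ℕ → Set (Finset (ZMod (12 * k + 10)))) : Prop where
  card_eq : ∀ α ≤ 12 * k + 8, ∀ p ∈ P α, p.card = 2
  factor : ∀ α ≤ 12 * k + 8, ∀ x, ∃! p, p ∈ P α ∧ x ∈ p
  once : ∀ p : Finset (ZMod (12 * k + 10)), p.card = 2 → ∃! α, α ≤ 12 * k + 8 ∧ p ∈ P α
  short : ∀ x y : ZMod (12 * k + 10), (∃ α < 4 * k + 2, {x, y} ∈ P α) ↔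
    ∃ d : ℕ, d ≤ 2 * k ∧
      (y - x = ((2 * d + 1 : ℕ) : ZMod (12 * k + 10)) ∨
      x - y = ((2 * d + 1 : ℕ) : ZMod (12 * k + 10)))

/-- The blocks of Hanani's construction of a quadruple system of order `3n - 8` from a quadruple
system `B` of order `n = 12k + 14` that has `{A0, A1, A2, A3}` as a block, with the pair
systems `P`. -/
inductive HananiBlock (k : ℕ) (B : Set (Finset (OldPt k)))
    (P : ℕ → Set (Finset (ZMod (12 * k + 10)))) : Finset (NewPt k) → Prop
  /-- `{A0, A1, A2, A3}` -/
  | special : HananiBlock k B P {specialPt 0, specialPt 1, specialPt 2, specialPt 3}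
  /-- `{ix, iy, iz, it}`, with `{x, y, z, t}` in `B` other than `{A0, A1, A2, A3}` -/
  | copy (i : ZMod 3) (b : Finset (OldPt k)) (hb : b ∈ B) (hne : b ≠ oldA k) :
      HananiBlock k B P (b.image (liftPt i))
  /-- `{Aa₁, 0a₂, 1a₃, 2a₄}` with `a₁ + a₂ + a₃ + a₄ = 0` -/
  | mixed (a₁ : Fin 4) (a₂ a₃ a₄ : ZMod (12 * k + 10))
      (h : (a₁.val : ZMod (12 * k + 10)) + a₂ + a₃ + a₄ = 0) :
      HananiBlock k B P {specialPt a₁, copyPt 0 a₂, copyPt 1 a₃, copyPt 2 a₄}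
  /-- `{(i+2)b₃, i(b₁+2k+1+i(4k+2)-d), i(b₁+2k+2+i(4k+2)+d), (i+1)b₂}` with `b₁ + b₂ + b₃ = 0`
  and `0 ≤ d ≤ 2k` -/
  | spread (i : ZMod 3) (b₁ b₂ b₃ : ZMod (12 * k + 10)) (d : ℕ) (hd : d ≤ 2 * k)
      (h : b₁ + b₂ + b₃ = 0) :
      HananiBlock k B P
        {copyPt (i + 2) b₃,
         copyPt i (b₁ + ((2 * k + 1 + i.val * (4 * k + 2) : ℕ) : ZMod (12 * k + 10)) - (d : ZMod (12 * k + 10))),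
         copyPt i (b₁ + ((2 * k + 2 + i.val * (4 * k + 2) : ℕ) : ZMod (12 * k + 10)) + (d : ZMod (12 * k + 10))),
         copyPt (i + 1) b₂}
  /-- `{ir, is, (i+1)r', (i+1)s'}` with `[r, s]` and `[r', s']` (possibly equal) in `P_α`,
  `4k + 2 ≤ α ≤ 12k + 8` -/
  | pairs (i : ZMod 3) (α : ℕ) (hα : 4 * k + 2 ≤ α) (hα' : α ≤ 12 * k + 8)
      (r s r' s' : ZMod (12 * k + 10)) (hp : {r, s} ∈ P α) (hp' : {r', s'} ∈ P α) :
      HananiBlock k B P {copyPt i r, copyPt i s, copyPt (i + 1) r', copyPt (i + 1) s'}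

/-- The block set of Hanani's construction. -/
def hananiBlocks (k : ℕ) (B : Set (Finset (OldPt k)))
    (P : ℕ → Set (Finset (ZMod (12 * k + 10)))) : Set (Finset (NewPt k)) :=
  {b | HananiBlock k B P b}

/-! Regard a block as an edge that may join any two of its points. A 1-overlap cycle is then a
closed trail that uses every block once, and, as for Euler circuits, it suffices to split the blocks
into closed trails and to glue these at common points (`IsCircuit.iUnion`).

The given cycle on the old system, cut open at {A0, A1, A2, A3}, is a trail between two points Ag
and Ah. Its three copies, the middle one reversed, together with the block {A0, A1, A2, A3} close up
to a circuit (`isCircuit_copyPart`). The blocks of the third kind with fixed Ah and 0x, and those of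
the fourth kind with fixed i, b₁, d, share two points and are 12k + 10 in number. This number is
even, so a walk can go back and forth between the two points (`IsCircuit.of_even`). The blocks of
the fifth kind fall into triangles: identify each P_α with a cyclic group and combine the pairs p,
p', p'' with p + p' + p'' = 0, placed in copies 0, 1, 2 (`exists_rotation_closed_op`). Everything is
connected: Ag is joined to all points 0x, each triangle has a point in copy 0 and leads to the other
copies, and the fourth kind with d = 0 joins ix to i(x + 1).

That the blocks form a quadruple system is a check of triples by position. Two points of one copy
with a third in another lie in a block of the fourth or of the fifth kind, according to the P_α that
contains the two. For one point in each copy the sum of the coordinates decides: four residues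
belong to the third kind, and the remaining 12k + 6 form three intervals of length 4k + 2, one for
each i in the fourth kind (`inUniqueBlock_transversal`). -/

/-! ### Trails through blocks, their translation to overlap cycles, and gluing of circuits. -/

section Trails

variable {X Y : Type*}

/-- `IsTrail S V x y`: there is a walk from `x` to `y` that visits exactly the points of `V` and
whose steps go between distinct points of a block, using every block of `S` exactly once. -/
inductive IsTrail : Set (Finset X) → Set X → X → X → Prop
  | nil (x : X) : IsTrail ∅ {x} x x
  | cons {S : Set (Finset X)} {V : Set X} {x y z : X} {b : Finset X} (hx : x ∈ b) (hy : y ∈ b)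
      (hxy : x ≠ y) (hb : b ∉ S) (h : IsTrail S V y z) : IsTrail (insert b S) (insert x V) x z

namespace IsTrail

variable {S T : Set (Finset X)} {V W : Set X} {x y z v : X}

lemma start_mem (h : IsTrail S V x y) : x ∈ V := by
  cases h <;> simp

lemma single {b : Finset X} (hx : x ∈ b) (hy : y ∈ b) (hxy : x ≠ y) :
    IsTrail {b} {x, y} x y := by
  simpa using cons hx hy hxy (Set.notMem_empty b) (nil y)

lemma append (h : IsTrail S V x y) (h' : IsTrail T W y z) (hd : Disjoint S T) :
    IsTrail (S ∪ T) (V ∪ W) x z := by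
  induction h with
  | nil x =>
    simpa [Set.insert_eq_of_mem h'.start_mem] using h'
  | cons hx hy hxy hb _ ih =>
    rw [Set.disjoint_insert_left] at hd
    rw [Set.insert_union, Set.insert_union]
    exact cons hx hy hxy (by simp [hb, hd.1]) (ih h' hd.2)

lemma reverse (h : IsTrail S V x y) : IsTrail S V y x := by
  induction h with
  | nil x => exact nil x
  | @cons S V x y z b hx hy hxy hb h ih =>
    have := ih.append (single hy hx hxy.symm) (by simpa using hb)
    have e : V ∪ {y, x} = insert x V := by
      have := h.start_mem
      ext u
      simp only [Set.mem_union, Set.mem_insert_iff, Set.mem_singleton_iff]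
      constructor
      · rintro (h | rfl | h) <;> tauto
      · tauto
    rwa [e, Set.union_singleton] at this

lemma split (h : IsTrail S V x y) (hv : v ∈ V) :
    ∃ S₁ S₂ V₁ V₂, S = S₁ ∪ S₂ ∧ V = V₁ ∪ V₂ ∧ Disjoint S₁ S₂ ∧
      IsTrail S₁ V₁ x v ∧ IsTrail S₂ V₂ v y := by
  induction h with
  | nil x =>
    obtain rfl : v = x := hv
    exact ⟨∅, ∅, {v}, {v}, by simp, by simp, by simp, nil v, nil v⟩
  | @cons S V x y z b hx hy hxy hb h ih =>
    by_cases hvx : v = x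
    · subst hvx
      exact ⟨∅, insert b S, {v}, insert v V, by simp, by simp, by simp, nil v,
        cons hx hy hxy hb h⟩
    · obtain ⟨S₁, S₂, V₁, V₂, rfl, rfl, hd, h₁, h₂⟩ := ih (hv.resolve_left hvx)
      rw [Set.mem_union, not_or] at hb
      exact ⟨insert b S₁, S₂, insert x V₁, V₂, by rw [Set.insert_union],
        by rw [Set.insert_union], Set.disjoint_insert_left.2 ⟨hb.2, hd⟩,
        cons hx hy hxy hb.1 h₁, h₂⟩

/-- Cut at `v` and swap the two pieces. Two circuits can thus both be based at a common point before
they are concatenated. -/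
lemma rotate (h : IsTrail S V x x) (hv : v ∈ V) : IsTrail S V v v := by
  obtain ⟨S₁, S₂, V₁, V₂, rfl, rfl, hd, h₁, h₂⟩ := h.split hv
  rw [Set.union_comm S₁, Set.union_comm V₁]
  exact h₂.append h₁ hd.symm

lemma map [DecidableEq Y] (f : X → Y) (hf : Function.Injective f) (h : IsTrail S V x y) :
    IsTrail (Finset.image f '' S) (f '' V) (f x) (f y) := by
  induction h with
  | nil x => simpa using nil (f x)
  | cons hx hy hxy hb _ ih =>
    rw [Set.image_insert_eq, Set.image_insert_eq]
    exact cons (Finset.mem_image_of_mem f hx) (Finset.mem_image_of_mem f hy) (hf.ne hxy)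
      (by rwa [(Finset.image_injective hf).mem_set_image]) ih

lemma exists_seq (h : IsTrail S V x y) : ∃ (N : ℕ) (b : ℕ → Finset X) (p : ℕ → X),
    p 0 = x ∧ p N = y ∧ (∀ i < N, p i ∈ b i ∧ p (i + 1) ∈ b i ∧ p i ≠ p (i + 1)) ∧
      Set.BijOn b (Set.Iio N) S := by
  induction h with
  | nil x =>
    exact ⟨0, fun _ => ∅, fun _ => x, rfl, rfl, by simp,
      by simp [Set.BijOn, Set.MapsTo, Set.SurjOn]⟩
  | @cons S V x y z b hx hy hxy hb h ih =>
    obtain ⟨N, c, p, h0, hN, hs, hm, hi, hsu⟩ := ih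
    refine ⟨N + 1, fun i => Nat.casesOn i b c, fun i => Nat.casesOn i x p, rfl, hN, ?_, ?_, ?_, ?_⟩
    · rintro (_ | i) hi
      · simpa [h0] using ⟨hx, hy, hxy⟩
      · exact hs i (by omega)
    · rintro (_ | i) hi
      · simp
      · exact Set.mem_insert_of_mem _ (hm (by simpa using hi))
    · rintro (_ | i) hi' (_ | j) hj' he
      · rfl
      · have : c j ∈ S := hm (by simpa using hj')
        exact absurd (show b = c j from he) (by rintro rfl; exact hb this)
      · have : c i ∈ S := hm (by simpa using hi')
        exact absurd (show c i = b from he) (by rintro rfl; exact hb this)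
      · rw [hi (by simpa using hi') (by simpa using hj') he]
    · rintro d (rfl | hd)
      · exact ⟨0, by simp, rfl⟩
      · obtain ⟨i, hi', rfl⟩ := hsu hd
        exact ⟨i + 1, by simpa using hi', rfl⟩

lemma admitsOcycle [DecidableEq X] (h : IsTrail S V x x) (hS : S.Nonempty) :
    AdmitsOcycle 1 S := by
  obtain ⟨N, b, p, h0, hN, hs, hb⟩ := h.exists_seq
  have hpos : 0 < N := by
    obtain ⟨c, hc⟩ := hS
    obtain ⟨i, hi, -⟩ := hb.surjOn hc
    exact lt_of_le_of_lt (Nat.zero_le i) hi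
  have : NeZero N := ⟨hpos.ne'⟩
  -- The string of a block starts at the point where the trail enters and ends where it leaves; the
  -- order of the other points is irrelevant.
  refine ⟨N, fun i => p i.val ::
    ((((b i.val).erase (p i.val)).erase (p (i.val + 1))).toList ++ [p (i.val + 1)]), hpos, ?_, ?_, ?_⟩
  · intro i
    have := hs i.val (ZMod.val_lt i)
    simp only [List.nodup_cons, List.nodup_append, Finset.nodup_toList]
    simp [this.2.2]
    grind
  · have e : (fun i : ZMod N => (p i.val ::
      ((((b i.val).erase (p i.val)).erase (p (i.val + 1))).toList ++
        [p (i.val + 1)])).toFinset) = b ∘ ZMod.val := by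
      funext i
      have := hs i.val (ZMod.val_lt i)
      ext u
      simp
      grind
    rw [e]
    refine hb.comp ⟨fun i _ => ZMod.val_lt i, (ZMod.val_injective N).injOn, fun i hi => ?_⟩
    exact ⟨(i : ZMod N), trivial, ZMod.val_cast_of_lt hi⟩
  · intro i
    have hlt := ZMod.val_lt i
    have hv : (i + 1).val = (i.val + 1) % N := by
      rw [ZMod.val_add, ZMod.val_one_eq_one_mod, Nat.add_mod_mod]
    have hp : p (i + 1).val = p (i.val + 1) := by
      rcases Nat.lt_or_ge (i.val + 1) N with h | h
      · rw [hv, Nat.mod_eq_of_lt h]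
      · have : i.val + 1 = N := by omega
        rw [hv, this, Nat.mod_self, h0, hN]
    dsimp only
    rw [hp, ← List.cons_append, List.rtake_eq_reverse_take_reverse]
    simp

/-- A one-overlap cycle, cut open at one of its blocks, is a trail through the other blocks. -/
lemma of_isOcycle [DecidableEq X] {N : ℕ} {w : ZMod N → List X} (h : IsOcycle 1 S N w)
    (h4 : ∀ b ∈ S, b.card = 4) {A : Finset X} (hA : A ∈ S) :
    ∃ x ∈ A, ∃ y ∈ A, x ≠ y ∧ ∃ V, IsTrail (S \ {A}) V y x := by
  obtain ⟨hpos, hnd, hbij, hov⟩ := h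
  have : NeZero N := ⟨hpos.ne'⟩
  have hw : ∀ i, ∃ a c l, w i = a :: (l ++ [c]) := by
    intro i
    have h1 := h4 _ (hbij.mapsTo (Set.mem_univ i))
    simp only [List.toFinset_card_of_nodup (hnd i)] at h1
    rcases hl : w i with _ | ⟨a, t⟩
    · simp [hl] at h1
    · rcases List.eq_nil_or_concat t with rfl | ⟨l, c, rfl⟩
      · simp [hl] at h1
      · exact ⟨a, c, l, by simp⟩
  choose a c l hw using hw
  have hca : ∀ i, c i = a (i + 1) := by
    intro i
    have := hov i
    rw [hw i, hw (i + 1), ← List.cons_append, List.rtake_eq_reverse_take_reverse] at this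
    simpa using this
  have hne : ∀ i, a i ≠ a (i + 1) := by
    intro i hi
    have := hnd i
    rw [hw i, hca i, ← hi] at this
    simp at this
  have ha : ∀ i, a i ∈ (w i).toFinset := fun i => by rw [hw i]; simp
  have ha' : ∀ i, a (i + 1) ∈ (w i).toFinset := fun i => by rw [← hca i, hw i]; simp
  obtain ⟨j, -, hj⟩ := hbij.surjOn hA
  -- The string at `j` lists `A`. The trail starts with the string after it; fewer than `N` steps
  -- repeat no index modulo `N`, and `n = N - 1` omits only `A`.
  have key : ∀ n < N, ∃ V, IsTrail ((fun t : ℕ => (w (j + 1 + t)).toFinset) '' Set.Iio n) V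
      (a (j + 1)) (a (j + 1 + n)) := by
    intro n
    induction n with
    | zero => exact fun _ => ⟨{a (j + 1)}, by simpa using nil (a (j + 1))⟩
    | succ n ih =>
      intro hn
      obtain ⟨V, hV⟩ := ih (by omega)
      have e : Set.Iio (n + 1) = insert n (Set.Iio n) := by
        ext; simp [Nat.le_iff_lt_or_eq, or_comm]
      refine ⟨V ∪ {a (j + 1 + n), a (j + 1 + n + 1)}, ?_⟩
      rw [e, Set.image_insert_eq, ← Set.union_singleton, Nat.cast_succ, ← add_assoc]
      refine hV.append (single (ha _) (ha' _) (hne _)) ?_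
      rw [Set.disjoint_singleton_right]
      rintro ⟨t, ht, he⟩
      have := hbij.injOn (Set.mem_univ _) (Set.mem_univ _) he
      have := congrArg ZMod.val (add_left_cancel this)
      rw [ZMod.val_cast_of_lt (lt_trans ht (by omega)), ZMod.val_cast_of_lt (by omega)] at this
      exact absurd this (ne_of_lt ht)
  obtain ⟨V, hV⟩ := key (N - 1) (by omega)
  have hlast : j + 1 + ((N - 1 : ℕ) : ZMod N) = j := by
    rw [Nat.cast_sub hpos]; simp
  have hset : (fun t : ℕ => (w (j + 1 + t)).toFinset) '' Set.Iio (N - 1) = S \ {A} := by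
    ext b
    constructor
    · rintro ⟨t, ht, rfl⟩
      refine ⟨hbij.mapsTo (Set.mem_univ _), fun he => ?_⟩
      have := hbij.injOn (Set.mem_univ _) (Set.mem_univ _) (he.trans hj.symm)
      rw [add_assoc, add_eq_left] at this
      have h2 : ((t + 1 : ℕ) : ZMod N) = 0 := by rw [← this]; push_cast; ring
      rw [ZMod.natCast_eq_zero_iff] at h2
      have := Nat.le_of_dvd (by omega) h2
      have : t < N - 1 := ht
      omega
    · rintro ⟨hb, hbA⟩
      obtain ⟨i, -, rfl⟩ := hbij.surjOn hb
      have hval : j + 1 + ((i - (j + 1)).val : ZMod N) = i := by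
        rw [ZMod.natCast_zmod_val]; ring
      refine ⟨(i - (j + 1)).val, ?_, by simp only [hval]⟩
      have hlt := ZMod.val_lt (i - (j + 1))
      rw [Set.mem_Iio]
      by_contra hge
      have : (i - (j + 1)).val = N - 1 := by omega
      rw [this, hlast] at hval
      subst hval
      exact hbA hj
  rw [hlast, hset] at hV
  exact ⟨a j, hj ▸ ha j, a (j + 1), hj ▸ ha' j, hne j, V, hV⟩

end IsTrail

/-- The blocks of `S` can be traversed once each by a closed walk that visits all points of `V`. -/
def IsCircuit (S : Set (Finset X)) (V : Set X) : Prop :=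
  ∃ (W : Set X) (v : X), V ⊆ W ∧ IsTrail S W v v

namespace IsCircuit

lemma union {S T : Set (Finset X)} {V W : Set X} (h : IsCircuit S V) (h' : IsCircuit T W)
    (hd : Disjoint S T) (hVW : (V ∩ W).Nonempty) : IsCircuit (S ∪ T) (V ∪ W) := by
  obtain ⟨V', v, hV, h⟩ := h
  obtain ⟨W', w, hW, h'⟩ := h'
  obtain ⟨c, hcV, hcW⟩ := hVW
  exact ⟨V' ∪ W', c, Set.union_subset_union hV hW,
    (h.rotate (hV hcV)).append (h'.rotate (hW hcW)) hd⟩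

/-- Circuits on pairwise disjoint block sets can be joined when no proper subfamily is closed under
meeting in a point. -/
lemma iUnion {ι : Type*} [Finite ι] {S : ι → Set (Finset X)} {V : ι → Set X} (o : ι)
    (h : ∀ j, IsCircuit (S j) (V j)) (hd : Pairwise fun j j' => Disjoint (S j) (S j'))
    (hc : ∀ Q : Set X, (∀ j, (V j ∩ Q).Nonempty → V j ⊆ Q) → V o ⊆ Q →
      ∀ j, (V j ∩ Q).Nonempty) :
    IsCircuit (⋃ j, S j) (⋃ j, V j) := by
  -- A maximal subfamily that contains `o` and already forms one circuit absorbs every part that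
  -- meets it, so `hc`, applied to its points, shows that it is the whole family.
  let G : Set (Set ι) := {K | o ∈ K ∧ IsCircuit (⋃ j ∈ K, S j) (⋃ j ∈ K, V j)}
  have ho : {o} ∈ G := ⟨rfl, by simpa using h o⟩
  obtain ⟨K, -, hK⟩ := (Set.toFinite G).exists_le_maximal ho
  have step : ∀ j, (V j ∩ ⋃ i ∈ K, V i).Nonempty → j ∈ K := by
    intro j hj
    by_contra hjK
    have hm : insert j K ∈ G := by
      refine ⟨Set.mem_insert_of_mem _ hK.prop.1, ?_⟩
      rw [Set.biUnion_insert, Set.biUnion_insert]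
      refine (h j).union hK.prop.2 ?_ hj
      rw [Set.disjoint_iUnion₂_right]
      intro i hi
      exact hd (by rintro rfl; exact hjK hi)
    exact hjK (hK.le_of_ge hm (Set.subset_insert _ _) (Set.mem_insert _ _))
  have hall : ∀ j, j ∈ K := fun j => step j <| hc _
    (fun i hi => Set.subset_biUnion_of_mem (step i hi)) (Set.subset_biUnion_of_mem hK.prop.1) j
  simpa [hall] using hK.prop.2

/-- An even number of blocks with two common points. -/
lemma of_even {F : Finset (Finset X)} {x y : X} (hxy : x ≠ y) (hx : ∀ b ∈ F, x ∈ b)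
    (hy : ∀ b ∈ F, y ∈ b) (hF : Even F.card) (hne : F.Nonempty) :
    IsCircuit (F : Set (Finset X)) {x, y} := by
  classical
  -- Each further block moves the start of the trail to the other of the two points, while the end
  -- stays at `x`.
  have key : ∀ F : Finset (Finset X), (∀ b ∈ F, x ∈ b) → (∀ b ∈ F, y ∈ b) →
      ∃ V : Set X, (F.Nonempty → y ∈ V) ∧
        IsTrail (F : Set (Finset X)) V (if Even F.card then x else y) x := by
    intro F
    induction F using Finset.induction_on with
    | empty => exact fun _ _ => ⟨{x}, by simp, by simpa using IsTrail.nil x⟩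
    | insert b F hb ih =>
      intro hx hy
      obtain ⟨V, hV, ht⟩ := ih (fun c hc => hx c (Finset.mem_insert_of_mem hc))
        (fun c hc => hy c (Finset.mem_insert_of_mem hc))
      have hxb := hx b (Finset.mem_insert_self _ _)
      have hyb := hy b (Finset.mem_insert_self _ _)
      rw [Finset.coe_insert, Finset.card_insert_of_notMem hb]
      by_cases he : Even F.card
      · have he' : ¬ Even (F.card + 1) := by simpa [Nat.even_add_one] using he
        rw [if_pos he] at ht
        rw [if_neg he']
        exact ⟨insert y V, fun _ => Set.mem_insert _ _,
          IsTrail.cons hyb hxb hxy.symm (by simpa using hb) ht⟩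
      · have he' : Even (F.card + 1) := by simpa [Nat.even_add_one] using he
        rw [if_neg he] at ht
        rw [if_pos he']
        exact ⟨insert x V, fun _ => Set.mem_insert_of_mem _ ht.start_mem,
          IsTrail.cons hxb hyb hxy (by simpa using hb) ht⟩
  obtain ⟨V, hV, ht⟩ := key F hx hy
  rw [if_pos hF] at ht
  refine ⟨V, x, ?_, ht⟩
  rintro u (rfl | rfl)
  exacts [ht.start_mem, hV hne]

/-- Three blocks that meet cyclically in three points. -/
lemma of_triangle {a b c : Finset X} {x y z : X} (hab : a ≠ b) (hbc : b ≠ c) (hac : a ≠ c)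
    (hxy : x ≠ y) (hyz : y ≠ z) (hxz : x ≠ z) (hxa : x ∈ a) (hya : y ∈ a) (hyb : y ∈ b)
    (hzb : z ∈ b) (hzc : z ∈ c) (hxc : x ∈ c) : IsCircuit {a, b, c} {x, y, z} := by
  refine ⟨_, x, ?_, .cons hxa hya hxy ?_ (.cons hyb hzb hyz ?_ (.single hzc hxc hxz.symm))⟩
  · intro u
    simp only [Set.mem_insert_iff, Set.mem_singleton_iff]
    tauto
  · simp [hab, hac]
  · simp [hbc]

end IsCircuit

end Trails

/-! ### Invariance under relabelling of the points. -/

section Relabel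

variable {X Y : Type*}

lemma IsSQS.relabel [Fintype X] [Fintype Y] {n : ℕ} {B : Set (Finset X)} (h : IsSQS n B)
    (e : X ≃ Y) : IsSQS n (relabel e B) := by
  obtain ⟨hc, h4, h3⟩ := h
  refine ⟨(Fintype.card_congr e).symm.trans hc, ?_, ?_⟩
  · rintro _ ⟨b, hb, rfl⟩
    simpa using h4 b hb
  · intro t ht
    obtain ⟨b, ⟨hb, htb⟩, hu⟩ := h3 (t.map e.symm.toEmbedding) (by simpa using ht)
    refine ⟨b.map e.toEmbedding, ⟨⟨b, hb, rfl⟩, ?_⟩, ?_⟩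
    · intro y hy
      rw [Finset.mem_map_equiv]
      exact htb (by simpa [Finset.mem_map_equiv] using hy)
    · rintro _ ⟨⟨c, hc, rfl⟩, htc⟩
      dsimp only at htc ⊢
      rw [hu c ⟨hc, ?_⟩]
      intro x hx
      rw [Finset.mem_map_equiv] at hx
      have := htc hx
      rw [Finset.mem_map_equiv] at this
      simpa using this

lemma AdmitsOcycle.relabel [DecidableEq X] [DecidableEq Y] {s : ℕ} {B : Set (Finset X)}
    (h : AdmitsOcycle s B) (e : X ≃ Y) : AdmitsOcycle s (relabel e B) := by
  obtain ⟨N, w, hN, hnd, hb, ho⟩ := h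
  refine ⟨N, fun i => (w i).map e, hN, fun i => (hnd i).map e.injective, ?_, ?_⟩
  · have e1 : (fun i => ((w i).map e).toFinset) =
        (fun b : Finset X => b.map e.toEmbedding) ∘ fun i => (w i).toFinset := by
      funext i
      ext y
      simp [← Equiv.eq_symm_apply]
    rw [e1]
    exact (Set.InjOn.bijOn_image (Finset.map_injective _).injOn).comp hb
  · intro i
    have := ho i
    rw [List.rtake_eq_reverse_take_reverse] at this ⊢
    rw [← List.map_reverse, ← List.map_take, ← List.map_reverse, this, List.map_take]

end Relabel

/-! ### Pair systems as families of fixed-point-free involutions. -/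

section PairSystem

variable {V : Type*} [DecidableEq V]

/-- The orbits of an involution without fixed points. -/
def orbitPairs (σ : V → V) : Set (Finset V) := {p | ∃ x, p = {x, σ x}}

lemma pair_eq_pair {x y u v : V} :
    ({x, y} : Finset V) = {u, v} ↔ (x = u ∧ y = v) ∨ (x = v ∧ y = u) := by
  rw [← Sym2.eq_iff, ← Finset.coe_inj]
  simp [Set.pair_eq_pair_iff]

lemma mem_orbitPairs {σ : V → V} (h : Function.Involutive σ) {x y : V} :
    {x, y} ∈ orbitPairs σ ↔ y = σ x := by
  constructor
  · rintro ⟨z, hz⟩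
    rcases pair_eq_pair.1 hz with ⟨rfl, rfl⟩ | ⟨rfl, rfl⟩
    · rfl
    · exact (h _).symm
  · rintro rfl
    exact ⟨x, rfl⟩

/-- Pair systems are given by involutions that send every point to every other point once. -/
lemma isPairSystem_orbitPairs {k : ℕ} (σ : ℕ → ZMod (12 * k + 10) → ZMod (12 * k + 10))
    (hσ : ∀ α, Function.Involutive (σ α)) (hne : ∀ α ≤ 12 * k + 8, ∀ x, σ α x ≠ x)
    (honce : ∀ x y, x ≠ y → ∃! α, α ≤ 12 * k + 8 ∧ y = σ α x)
    (hshort : ∀ x y, (∃ α < 4 * k + 2, y = σ α x) ↔ ∃ d : ℕ, d ≤ 2 * k ∧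
      (y - x = ((2 * d + 1 : ℕ) : ZMod (12 * k + 10)) ∨
      x - y = ((2 * d + 1 : ℕ) : ZMod (12 * k + 10)))) :
    IsPairSystem k fun α => orbitPairs (σ α) where
  card_eq := by
    rintro α hα _ ⟨x, rfl⟩
    exact Finset.card_pair (hne α hα x).symm
  factor := by
    intro α hα x
    refine ⟨{x, σ α x}, ⟨⟨x, rfl⟩, by simp⟩, ?_⟩
    rintro _ ⟨⟨y, rfl⟩, hx⟩
    rw [Finset.mem_insert, Finset.mem_singleton] at hx
    rcases hx with rfl | rfl
    · rfl
    · rw [hσ α y, Finset.pair_comm]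
  once := by
    intro p hp
    obtain ⟨x, y, hxy, rfl⟩ := Finset.card_eq_two.1 hp
    simpa only [mem_orbitPairs (hσ _)] using honce x y hxy
  short := by
    intro x y
    simpa only [mem_orbitPairs (hσ _)] using hshort x y

end PairSystem

/-! ### An explicit pair system. -/

section Existence

variable (k : ℕ)

/-- The `α`-th shift from an even to an odd number. -/
def oddShift (α : ℕ) : ℤ := if Even α then α + 1 else -α

/-- Even numbers move by `δ`, odd numbers by `-δ`. -/
def parityShift (δ : ℤ) (x : ZMod (12 * k + 10)) : ZMod (12 * k + 10) :=
  if Even x.val then x + δ else x - δ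

/-- The reflection in `c`, with its fixed points exchanged. -/
def reflection (c : ℤ) (x : ZMod (12 * k + 10)) : ZMod (12 * k + 10) :=
  if 2 * x = c then x + (6 * k + 5 : ℤ) else c - x

/-- The involutions of a pair system: parity shifts, followed by reflections. -/
def pairInvolution (α : ℕ) : ZMod (12 * k + 10) → ZMod (12 * k + 10) :=
  if α < 6 * k + 4 then parityShift k (oddShift α) else reflection k (2 * (α - (6 * k + 4)))

variable {k}

/-- For integers less than two moduli apart a congruence is a choice of three linear equations,
which `omega` can handle. -/
lemma intCast_eq_intCast_iff_of_lt {a b : ℤ} (h : a - b < 2 * (12 * k + 10))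
    (h' : b - a < 2 * (12 * k + 10)) : (a : ZMod (12 * k + 10)) = b ↔
    a = b ∨ a = b + (12 * k + 10) ∨ b = a + (12 * k + 10) := by
  rw [ZMod.intCast_eq_intCast_iff_dvd_sub]
  push_cast
  constructor
  · rintro ⟨q, hq⟩
    have h1 : q < 2 := by nlinarith
    have h2 : -2 < q := by nlinarith
    obtain rfl | rfl | rfl : q = -1 ∨ q = 0 ∨ q = 1 := by omega
    all_goals omega
  · rintro (h | h | h)
    · exact ⟨0, by omega⟩
    · exact ⟨-1, by omega⟩
    · exact ⟨1, by omega⟩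

/-- Parity is well defined on residues because the modulus is even. -/
lemma even_val_intCast (a : ℤ) : Even (a : ZMod (12 * k + 10)).val ↔ Even a := by
  have h := ZMod.val_intCast (n := 12 * k + 10) a
  have h2 := Int.emod_add_mul_ediv a ((12 * k + 10 : ℕ) : ℤ)
  rw [← h] at h2
  have : Even (((12 * k + 10 : ℕ) : ℤ) * (a / ((12 * k + 10 : ℕ) : ℤ))) :=
    Even.mul_right (by rw [Int.even_coe_nat]; exact ⟨6 * k + 5, by ring⟩) _
  conv_rhs => rw [← h2, Int.even_add]
  simp only [this, iff_true, Int.even_coe_nat]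

lemma parityShift_intCast (δ a : ℤ) : parityShift k δ (a : ZMod (12 * k + 10)) =
    ((if Even a then a + δ else a - δ : ℤ) : ZMod (12 * k + 10)) := by
  unfold parityShift
  simp only [even_val_intCast]
  split_ifs <;> push_cast <;> rfl

lemma odd_oddShift (α : ℕ) : Odd (oddShift α) := by
  unfold oddShift
  split_ifs with h
  · exact (Int.even_coe_nat α |>.2 h).add_one
  · rw [Nat.not_even_iff_odd] at h
    exact (Int.odd_coe_nat α |>.2 h).neg

/-- An odd shift changes the parity, so the second application has the opposite sign. -/
lemma parityShift_involutive {δ : ℤ} (hδ : Odd δ) : Function.Involutive (parityShift k δ) := by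
  intro x
  obtain ⟨a, rfl⟩ := ZMod.intCast_surjective x
  rw [parityShift_intCast, parityShift_intCast]
  by_cases h : Even a
  · have : ¬ Even (a + δ) := by simp [Int.even_add, h, hδ]
    simp [h, this]
  · have : Even (a - δ) := by simp [Int.even_sub, h, hδ]
    simp [h, this]

/-- Adding `6k + 5`, half of the modulus, preserves `2x = c`, hence exchanges the two fixed points
of `x ↦ c - x`. -/
lemma reflection_involutive (c : ℤ) : Function.Involutive (reflection k c) := by
  have h0 : ((12 * k + 10 : ℕ) : ZMod (12 * k + 10)) = 0 := ZMod.natCast_self _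
  push_cast at h0
  intro x
  unfold reflection
  by_cases h : 2 * x = c
  · rw [if_pos h]
    push_cast
    rw [if_pos (by linear_combination h + h0)]
    linear_combination h0
  · rw [if_neg h, if_neg]
    · ring
    · intro h'
      exact h (by linear_combination -h')

lemma pairInvolution_involutive (α : ℕ) : Function.Involutive (pairInvolution k α) := by
  unfold pairInvolution
  split_ifs
  · exact parityShift_involutive (odd_oddShift α)
  · exact reflection_involutive _

lemma eq_pairInvolution_iff {a b : ℤ} (ha : 0 ≤ a) (ha' : a < 12 * k + 10) (hb : 0 ≤ b)
    (hb' : b < 12 * k + 10) {α : ℕ} (hα : α ≤ 12 * k + 8) :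
    (b : ZMod (12 * k + 10)) = pairInvolution k α a ↔
      if α < 6 * k + 4 then
        if a % 2 = 0 then
          if α % 2 = 0 then b = a + (α + 1) ∨ b + (12 * k + 10) = a + (α + 1)
          else b = a - α ∨ b = a - α + (12 * k + 10)
        else
          if α % 2 = 0 then b = a - (α + 1) ∨ b = a - (α + 1) + (12 * k + 10)
          else b = a + α ∨ b + (12 * k + 10) = a + α
      else
        if a = α - (6 * k + 4) ∨ a = α - (6 * k + 4) + (6 * k + 5) then
          b = a + (6 * k + 5) ∨ a = b + (6 * k + 5)
        else a + b = 2 * (α - (6 * k + 4)) ∨ a + b = 2 * (α - (6 * k + 4)) + (12 * k + 10) := by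
  unfold pairInvolution
  by_cases h : α < 6 * k + 4
  · rw [if_pos h, if_pos h, parityShift_intCast, oddShift]
    simp only [Nat.even_iff, Int.even_iff]
    split_ifs <;> rw [intCast_eq_intCast_iff_of_lt (by omega) (by omega)] <;> omega
  · rw [if_neg h, if_neg h, reflection]
    have e : 2 * (a : ZMod (12 * k + 10)) = ((2 * a : ℤ) : ZMod (12 * k + 10)) := by push_cast; rfl
    rw [e]
    simp only [intCast_eq_intCast_iff_of_lt (k := k) (a := 2 * a) (b := 2 * (α - (6 * k + 4)))
      (by omega) (by omega)]
    rw [← Int.cast_add, ← Int.cast_sub]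
    split_ifs
    any_goals omega
    all_goals rw [intCast_eq_intCast_iff_of_lt (by omega) (by omega)]
    all_goals omega

lemma exists_intCast (x : ZMod (12 * k + 10)) : ∃ a : ℤ, 0 ≤ a ∧ a < 12 * k + 10 ∧ x = a :=
  ⟨x.val, by omega, by exact_mod_cast ZMod.val_lt x, by simp⟩

/-- The shifts run through `±1, ±3, …, ±(6k + 3)`, the first `4k + 2` of them up to `±(4k + 1)`;
they cover the pairs with odd difference other than `6k + 5`. The reflections in all even `c` cover
the pairs with even difference, and each exchanges one pair with difference `6k + 5`. -/
theorem exists_isPairSystem (k : ℕ) : ∃ P, IsPairSystem k P := by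
  refine ⟨_, isPairSystem_orbitPairs (pairInvolution k) pairInvolution_involutive ?_ ?_ ?_⟩
  · intro α hα x hx
    obtain ⟨a, ha, ha', rfl⟩ := exists_intCast x
    rw [eq_comm, eq_pairInvolution_iff ha ha' ha ha' hα] at hx
    split_ifs at hx <;> omega
  · intro x y hxy
    obtain ⟨a, ha, ha', rfl⟩ := exists_intCast x
    obtain ⟨b, hb, hb', rfl⟩ := exists_intCast y
    have hab : a ≠ b := by rintro rfl; exact hxy rfl
    refine existsUnique_of_exists_of_unique ?_ ?_
    · have key : ∀ α : ℤ, 0 ≤ α → α ≤ 12 * k + 8 → _ := fun α h0 h1 =>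
        eq_pairInvolution_iff (k := k) ha ha' hb hb' (α := α.toNat) (by omega)
      by_cases hpar : (a + b) % 2 = 0
      -- The reflection is in `c = a + b`, reduced modulo `12k + 10`; its index is `6k + 4 + c / 2`.
      · rcases lt_or_ge (a + b) (12 * k + 10) with h | h
        · refine ⟨(6 * k + 4 + (a + b) / 2).toNat, by omega,
            (key _ (by omega) (by omega)).2 ?_⟩
          split_ifs <;> omega
        · refine ⟨((a + b) / 2 - 1).toNat, by omega, (key _ (by omega) (by omega)).2 ?_⟩
          split_ifs <;> omega
      by_cases hopp : b = a + (6 * k + 5) ∨ a = b + (6 * k + 5)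
      -- Both points are fixed by `x ↦ c - x` with `c = 2 min(a, b)`.
      · refine ⟨(6 * k + 4 + min a b).toNat, by omega, (key _ (by omega) (by omega)).2 ?_⟩
        split_ifs <;> omega
      -- `δ` is the displacement from the even to the odd point, reduced to the smallest absolute
      -- value. A positive `δ` is `oddShift (δ - 1)`, a negative one is `oddShift (-δ)`.
      obtain ⟨δ, hδ, h1, h2⟩ : ∃ δ : ℤ, (a % 2 = 0 ∧ (δ = b - a ∨ δ = b - a + (12 * k + 10) ∨
          δ = b - a - (12 * k + 10)) ∨ a % 2 = 1 ∧ (δ = a - b ∨ δ = a - b + (12 * k + 10) ∨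
          δ = a - b - (12 * k + 10))) ∧ δ < 6 * k + 5 ∧ - (6 * k + 5) < δ := by
        obtain ⟨δ, hδ⟩ : ∃ δ : ℤ, a % 2 = 0 ∧ δ = b - a ∨ a % 2 = 1 ∧ δ = a - b := by
          rcases Int.emod_two_eq_zero_or_one a with h | h
          exacts [⟨_, .inl ⟨h, rfl⟩⟩, ⟨_, .inr ⟨h, rfl⟩⟩]
        rcases lt_or_ge δ (6 * k + 5) with h | h
        · rcases lt_or_ge (-(6 * k + 5) : ℤ) δ with h' | h'
          · exact ⟨δ, by omega⟩
          · exact ⟨δ + (12 * k + 10), by omega⟩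
        · exact ⟨δ - (12 * k + 10), by omega⟩
      rcases lt_or_ge 0 δ with h | h
      · refine ⟨(δ - 1).toNat, by omega, (key _ (by omega) (by omega)).2 ?_⟩
        split_ifs <;> omega
      · refine ⟨(-δ).toNat, by omega, (key _ (by omega) (by omega)).2 ?_⟩
        split_ifs <;> omega
    · rintro α β ⟨hα, h⟩ ⟨hβ, h'⟩
      rw [eq_pairInvolution_iff ha ha' hb hb' hα] at h
      rw [eq_pairInvolution_iff ha ha' hb hb' hβ] at h'
      split_ifs at h h' <;> omega
  · intro x y
    obtain ⟨a, ha, ha', rfl⟩ := exists_intCast x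
    obtain ⟨b, hb, hb', rfl⟩ := exists_intCast y
    have key : ∀ d : ℕ, d ≤ 2 * k →
        (((b : ZMod (12 * k + 10)) - a = ((2 * d + 1 : ℕ) : ZMod (12 * k + 10)) ∨
        (a : ZMod (12 * k + 10)) - b = ((2 * d + 1 : ℕ) : ZMod (12 * k + 10))) ↔
        (b = a + (2 * d + 1) ∨ b + (12 * k + 10) = a + (2 * d + 1)) ∨
        (a = b + (2 * d + 1) ∨ a + (12 * k + 10) = b + (2 * d + 1))) := by
      intro d hd
      have e : ((2 * d + 1 : ℕ) : ZMod (12 * k + 10)) = ((2 * d + 1 : ℤ) : ZMod (12 * k + 10)) := by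
        push_cast; rfl
      rw [e, ← Int.cast_sub, ← Int.cast_sub, intCast_eq_intCast_iff_of_lt (by omega) (by omega),
        intCast_eq_intCast_iff_of_lt (by omega) (by omega)]
      omega
    constructor
    · rintro ⟨α, hα, h⟩
      rw [eq_pairInvolution_iff ha ha' hb hb' (by omega), if_pos (by omega)] at h
      refine ⟨α / 2, by omega, (key _ (by omega)).2 ?_⟩
      split_ifs at h <;> omega
    · rintro ⟨d, hd, h⟩
      rw [key d hd] at h
      have h1 := eq_pairInvolution_iff (k := k) ha ha' hb hb' (α := 2 * d) (by omega)
      have h2 := eq_pairInvolution_iff (k := k) ha ha' hb hb' (α := 2 * d + 1) (by omega)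
      rw [if_pos (by omega)] at h1 h2
      have : (b : ZMod (12 * k + 10)) = pairInvolution k (2 * d) a ∨
          (b : ZMod (12 * k + 10)) = pairInvolution k (2 * d + 1) a := by
        rw [h1, h2]
        split_ifs <;> omega
      rcases this with h | h
      exacts [⟨2 * d, by omega, h⟩, ⟨2 * d + 1, by omega, h⟩]

end Existence

/-! ### The five kinds of blocks and membership in them. -/

section Blocks

variable {k : ℕ}

lemma zmodThree_facts (i : ZMod 3) : i + 1 ≠ i ∧ i + 2 ≠ i ∧ i + 1 ≠ i + 2 ∧ i + 1 + 1 = i + 2 ∧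
    i + 2 + 1 = i ∧ i + 1 + 2 = i ∧ i + 2 + 2 = i + 1 := by
  decide +revert

lemma zmodThree_cases {i j : ZMod 3} (h : j ≠ i) : j = i + 1 ∨ j = i + 2 := by
  decide +revert

@[simp] lemma copyPt_inj {i j : ZMod 3} {x y : ZMod (12 * k + 10)} :
    copyPt i x = copyPt j y ↔ i = j ∧ x = y := by
  simp [copyPt]

@[simp] lemma specialPt_inj {g h : Fin 4} : (specialPt g : NewPt k) = specialPt h ↔ g = h := by
  simp [specialPt]

@[simp] lemma copyPt_ne_specialPt {i : ZMod 3} {x : ZMod (12 * k + 10)} {h : Fin 4} :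
    copyPt i x ≠ specialPt h := by
  simp [copyPt, specialPt]

@[simp] lemma specialPt_ne_copyPt {i : ZMod 3} {x : ZMod (12 * k + 10)} {h : Fin 4} :
    specialPt h ≠ copyPt i x := by
  simp [copyPt, specialPt]

lemma liftPt_injective (i : ZMod 3) : Function.Injective (liftPt (k := k) i) := by
  rintro (x | g) (y | h) <;> simp [liftPt]

/-- The block `{A0, A1, A2, A3}` of new points. -/
def newA (k : ℕ) : Finset (NewPt k) := {specialPt 0, specialPt 1, specialPt 2, specialPt 3}

/-- The copy of a block with prefix `i`. -/
def copyBlock (i : ZMod 3) (b : Finset (OldPt k)) : Finset (NewPt k) := b.image (liftPt i)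

/-- The block through `Ah`, `0x` and `1y` of the third kind. -/
def mixedBlock (h : Fin 4) (x y : ZMod (12 * k + 10)) : Finset (NewPt k) :=
  {specialPt h, copyPt 0 x, copyPt 1 y, copyPt 2 (-((h.val : ZMod (12 * k + 10)) + x + y))}

/-- The offset of the blocks of the fourth kind in copy `i`. -/
def spreadOffset (k : ℕ) (i : ZMod 3) : ℕ := 2 * k + 1 + i.val * (4 * k + 2)

/-- The block of the fourth kind with parameters `i`, `b₁`, `b₂` and `d`. -/
def spreadBlock (i : ZMod 3) (b₁ b₂ : ZMod (12 * k + 10)) (d : ℕ) : Finset (NewPt k) :=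
  {copyPt (i + 2) (-(b₁ + b₂)), copyPt (k := k) i (b₁ + spreadOffset k i - d),
    copyPt (k := k) i (b₁ + spreadOffset k i + 1 + d), copyPt (i + 1) b₂}

/-- The block of the fifth kind with the pair `p` in copy `i` and the pair `p'` in copy `i + 1`. -/
def pairBlock (i : ZMod 3) (p p' : Finset (ZMod (12 * k + 10))) : Finset (NewPt k) :=
  p.image (copyPt i) ∪ p'.image (copyPt (i + 1))

@[simp] lemma copyPt_notMem_newA {j : ZMod 3} {x : ZMod (12 * k + 10)} :
    copyPt j x ∉ newA k := by
  simp [newA]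

@[simp] lemma specialPt_mem_newA {h : Fin 4} : specialPt h ∈ newA k := by
  fin_cases h <;> simp [newA]

@[simp] lemma copyPt_mem_copyBlock {i j : ZMod 3} {x : ZMod (12 * k + 10)}
    {b : Finset (OldPt k)} : copyPt j x ∈ copyBlock i b ↔ j = i ∧ .inl x ∈ b := by
  simp [copyBlock, liftPt]
  tauto

@[simp] lemma specialPt_mem_copyBlock {i : ZMod 3} {h : Fin 4}
    {b : Finset (OldPt k)} : specialPt h ∈ copyBlock i b ↔ .inr h ∈ b := by
  simp [copyBlock, liftPt]

@[simp] lemma copyPt_mem_mixedBlock {j : ZMod 3} {h : Fin 4} {x y z : ZMod (12 * k + 10)} :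
    copyPt j z ∈ mixedBlock h x y ↔
      j = 0 ∧ z = x ∨ j = 1 ∧ z = y ∨ j = 2 ∧ z = -((h.val : ZMod (12 * k + 10)) + x + y) := by
  simp [mixedBlock, -neg_add_rev]

@[simp] lemma specialPt_mem_mixedBlock {g h : Fin 4} {x y : ZMod (12 * k + 10)} :
    specialPt g ∈ mixedBlock h x y ↔ g = h := by
  simp [mixedBlock, -neg_add_rev]

@[simp] lemma copyPt_mem_spreadBlock {i j : ZMod 3} {b₁ b₂ z : ZMod (12 * k + 10)} {d : ℕ} :
    copyPt j z ∈ spreadBlock i b₁ b₂ d ↔ j = i + 2 ∧ z = -(b₁ + b₂) ∨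
      j = i ∧ (z = b₁ + spreadOffset k i - d ∨ z = b₁ + spreadOffset k i + 1 + d) ∨
      j = i + 1 ∧ z = b₂ := by
  simp [spreadBlock, -neg_add_rev]
  tauto

@[simp] lemma specialPt_notMem_spreadBlock {i : ZMod 3} {b₁ b₂ : ZMod (12 * k + 10)} {d : ℕ}
    {h : Fin 4} : specialPt h ∉ spreadBlock i b₁ b₂ d := by
  simp [spreadBlock]

@[simp] lemma copyPt_mem_pairBlock {i j : ZMod 3} {p p' : Finset (ZMod (12 * k + 10))}
    {z : ZMod (12 * k + 10)} :
    copyPt j z ∈ pairBlock i p p' ↔ j = i ∧ z ∈ p ∨ j = i + 1 ∧ z ∈ p' := by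
  simp [pairBlock]
  tauto

@[simp] lemma specialPt_notMem_pairBlock {i : ZMod 3} {p p' : Finset (ZMod (12 * k + 10))}
    {h : Fin 4} : specialPt h ∉ pairBlock i p p' := by
  simp [pairBlock]

variable {B : Set (Finset (OldPt k))} {P : ℕ → Set (Finset (ZMod (12 * k + 10)))}

lemma spreadBlock_eq {i : ZMod 3} {b₁ b₂ b₃ : ZMod (12 * k + 10)} {d : ℕ}
    (h : b₁ + b₂ + b₃ = 0) : {copyPt (i + 2) b₃,
      copyPt i (b₁ + ((2 * k + 1 + i.val * (4 * k + 2) : ℕ) : ZMod (12 * k + 10)) -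
        (d : ZMod (12 * k + 10))),
      copyPt i (b₁ + ((2 * k + 2 + i.val * (4 * k + 2) : ℕ) : ZMod (12 * k + 10)) +
        (d : ZMod (12 * k + 10))),
      copyPt (i + 1) b₂} = spreadBlock i b₁ b₂ d := by
  have e : ((2 * k + 2 + i.val * (4 * k + 2) : ℕ) : ZMod (12 * k + 10)) =
      (spreadOffset k i : ZMod (12 * k + 10)) + 1 := by
    rw [spreadOffset]; push_cast; ring
  rw [spreadBlock, ← eq_neg_of_add_eq_zero_right h, e, ← add_assoc]
  rfl

/-- Solving the sum conditions for the last coordinate leaves only free parameters, and the fifth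
kind is expressed by whole pairs; all later case distinctions use this form. -/
lemma mem_hananiBlocks_iff (hP : IsPairSystem k P) {b : Finset (NewPt k)} :
    b ∈ hananiBlocks k B P ↔ b = newA k ∨ (∃ i, ∃ c ∈ B, c ≠ oldA k ∧ b = copyBlock i c) ∨
      (∃ h x y, b = mixedBlock h x y) ∨ (∃ i b₁ b₂ d, d ≤ 2 * k ∧ b = spreadBlock i b₁ b₂ d) ∨
      ∃ i α p p', 4 * k + 2 ≤ α ∧ α ≤ 12 * k + 8 ∧ p ∈ P α ∧ p' ∈ P α ∧ b = pairBlock i p p' := by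
  constructor
  · rintro (_ | ⟨i, c, hc, hne⟩ | ⟨h, x, y, z, hs⟩ | ⟨i, b₁, b₂, b₃, d, hd, hs⟩ |
      ⟨i, α, hα, hα', r, s, r', s', hp, hp'⟩)
    · exact .inl rfl
    · exact .inr (.inl ⟨i, c, hc, hne, rfl⟩)
    · refine .inr (.inr (.inl ⟨h, x, y, ?_⟩))
      rw [mixedBlock, ← eq_neg_of_add_eq_zero_right hs]
    · refine .inr (.inr (.inr (.inl ⟨i, b₁, b₂, d, hd, spreadBlock_eq hs⟩)))
    · refine .inr (.inr (.inr (.inr ⟨i, α, _, _, hα, hα', hp, hp', ?_⟩)))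
      ext u
      simp [pairBlock]
      tauto
  · rintro (rfl | ⟨i, c, hc, hne, rfl⟩ | ⟨h, x, y, rfl⟩ | ⟨i, b₁, b₂, d, hd, rfl⟩ |
      ⟨i, α, p, p', hα, hα', hp, hp', rfl⟩)
    · exact .special
    · exact .copy i c hc hne
    · exact .mixed h x y _ (by ring)
    · rw [← spreadBlock_eq (add_neg_cancel (b₁ + b₂))]
      exact .spread i b₁ b₂ _ d hd (add_neg_cancel _)
    · obtain ⟨r, s, -, rfl⟩ := Finset.card_eq_two.1 (hP.card_eq α hα' p hp)
      obtain ⟨r', s', -, rfl⟩ := Finset.card_eq_two.1 (hP.card_eq α hα' p' hp')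
      have := HananiBlock.pairs (B := B) i α hα hα' r s r' s' hp hp'
      show HananiBlock k B P _
      convert this using 1
      ext u
      simp [pairBlock]
      tauto

lemma natCast_inj_of_lt {a b : ℕ} (ha : a < 12 * k + 10) (hb : b < 12 * k + 10)
    (h : (a : ZMod (12 * k + 10)) = b) : a = b := by
  have := congrArg ZMod.val h
  rwa [ZMod.val_cast_of_lt ha, ZMod.val_cast_of_lt hb] at this

lemma spread_endpoints_ne {d : ℕ} (hd : d ≤ 2 * k) (x : ZMod (12 * k + 10)) :
    x - d ≠ x + 1 + d := by
  intro h
  have h' : ((2 * d + 1 : ℕ) : ZMod (12 * k + 10)) = (0 : ℕ) := by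
    push_cast
    linear_combination -h
  exact absurd (natCast_inj_of_lt (by omega) (by omega) h') (by omega)

lemma card_of_mem_hananiBlocks (hP : IsPairSystem k P) (hB : ∀ b ∈ B, b.card = 4)
    {b : Finset (NewPt k)} (hb : b ∈ hananiBlocks k B P) : b.card = 4 := by
  rcases (mem_hananiBlocks_iff hP).1 hb with rfl | ⟨i, c, hc, hne, rfl⟩ | ⟨h, x, y, rfl⟩ |
    ⟨i, b₁, b₂, d, hd, rfl⟩ | ⟨i, α, p, p', hα, hα', hp, hp', rfl⟩
  · simp [newA]
  · rw [copyBlock, Finset.card_image_of_injective _ (liftPt_injective i), hB c hc]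
  · rw [mixedBlock]
    repeat rw [Finset.card_insert_of_notMem]
    all_goals simp
    all_goals exact fun h => absurd h (by decide)
  · have := zmodThree_facts i
    have := spread_endpoints_ne hd (b₁ + spreadOffset k i)
    rw [spreadBlock]
    repeat rw [Finset.card_insert_of_notMem]
    all_goals simp
    all_goals grind
  · have := zmodThree_facts i
    rw [pairBlock, Finset.card_union_of_disjoint, Finset.card_image_of_injective,
      Finset.card_image_of_injective, hP.card_eq α hα' p hp, hP.card_eq α hα' p' hp']
    · intro x y; simp
    · intro x y; simp
    · rw [Finset.disjoint_left]
      simp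

end Blocks

/-! ### Steiner property: triples within one lifted copy, and triples with one point `Ah`. -/

section Triples

variable {k : ℕ}

/-- The three points lie in exactly one block. -/
def InUniqueBlock {X : Type*} (H : Set (Finset X)) (u v w : X) : Prop :=
  ∃! b, b ∈ H ∧ u ∈ b ∧ v ∈ b ∧ w ∈ b

/-- With `InUniqueBlock.swap_right` this gives all permutations, so each type of triple is treated
in one order only. -/
lemma InUniqueBlock.swap_left {X : Type*} {H : Set (Finset X)} {u v w : X}
    (h : InUniqueBlock H u v w) : InUniqueBlock H v u w := by
  simpa only [InUniqueBlock, and_left_comm] using h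

lemma InUniqueBlock.swap_right {X : Type*} {H : Set (Finset X)} {u v w : X}
    (h : InUniqueBlock H u v w) : InUniqueBlock H u w v :=
  (existsUnique_congr fun b => by tauto).1 h

lemma isSQS_iff_inUniqueBlock {X : Type*} [Fintype X] {n : ℕ} {H : Set (Finset X)} :
    IsSQS n H ↔ Fintype.card X = n ∧ (∀ b ∈ H, b.card = 4) ∧
      ∀ u v w, u ≠ v → u ≠ w → v ≠ w → InUniqueBlock H u v w := by
  classical
  unfold IsSQS InUniqueBlock
  refine and_congr_right fun _ => and_congr_right fun _ => ⟨fun h u v w huv huw hvw => ?_,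
    fun h t ht => ?_⟩
  · simpa [Finset.insert_subset_iff] using
      h {u, v, w} (Finset.card_eq_three.2 ⟨u, v, w, huv, huw, hvw, rfl⟩)
  · obtain ⟨u, v, w, huv, huw, hvw, rfl⟩ := Finset.card_eq_three.1 ht
    simpa [Finset.insert_subset_iff] using h u v w huv huw hvw

variable {B : Set (Finset (OldPt k))} {P : ℕ → Set (Finset (ZMod (12 * k + 10)))}

lemma IsPairSystem.eq_of_mem (hP : IsPairSystem k P) {α : ℕ} (hα : α ≤ 12 * k + 8)
    {p : Finset (ZMod (12 * k + 10))} (hp : p ∈ P α) {x y : ZMod (12 * k + 10)} (hx : x ∈ p)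
    (hy : y ∈ p) (hxy : x ≠ y) : p = {x, y} := by
  refine (Finset.eq_of_subset_of_card_le ?_ ?_).symm
  · simp [Finset.insert_subset_iff, hx, hy]
  · rw [hP.card_eq α hα p hp, Finset.card_pair hxy]

lemma mem_oldA {u : OldPt k} : u ∈ oldA k ↔ ∃ h, u = .inr h := by
  rcases u with x | h
  · simp [oldA]
  · simp only [oldA, Finset.mem_insert, Finset.mem_singleton, Sum.inr.injEq, exists_eq', iff_true]
    decide +revert

/-- Blocks of the last three kinds have at most two points in copy `i` together with the `Ah`, so
only lifted old blocks compete, and uniqueness is inherited from `B`. -/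
lemma inUniqueBlock_lift (hP : IsPairSystem k P) (hB : IsSQS (12 * k + 14) B) (hA : oldA k ∈ B)
    (i : ZMod 3) {u v w : OldPt k} (huv : u ≠ v) (huw : u ≠ w) (hvw : v ≠ w) :
    InUniqueBlock (hananiBlocks k B P) (liftPt i u) (liftPt i v) (liftPt i w) := by
  obtain ⟨c, ⟨hc, hu, hv, hw⟩, hcu⟩ := (isSQS_iff_inUniqueBlock.1 hB).2.2 u v w huv huw hvw
  have key : ∀ b ∈ hananiBlocks k B P, liftPt i u ∈ b → liftPt i v ∈ b → liftPt i w ∈ b →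
      (c = oldA k ∧ b = newA k) ∨ (c ≠ oldA k ∧ b = copyBlock i c) := by
    intro b hb h1 h2 h3
    rcases (mem_hananiBlocks_iff hP).1 hb with rfl | ⟨i', c', hc', hne, rfl⟩ | ⟨h, x, y, rfl⟩ |
      ⟨i', b₁, b₂, d, hd, rfl⟩ | ⟨i', α, p, p', hα, hα', hp, hp', rfl⟩
    · refine .inl ⟨(hcu _ ⟨hA, ?_, ?_, ?_⟩).symm, rfl⟩ <;> rw [mem_oldA]
      · rcases u with x | g
        · simp [liftPt] at h1
        · exact ⟨g, rfl⟩
      · rcases v with x | g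
        · simp [liftPt] at h2
        · exact ⟨g, rfl⟩
      · rcases w with x | g
        · simp [liftPt] at h3
        · exact ⟨g, rfl⟩
    · have mem : ∀ t : OldPt k, liftPt i t ∈ copyBlock i' c' → t ∈ c' ∧ (i = i' ∨ t ∈ oldA k) := by
        rintro (x | g) ht
        · simp [liftPt] at ht
          tauto
        · simp [liftPt] at ht
          exact ⟨ht, .inr (mem_oldA.2 ⟨g, rfl⟩)⟩
      obtain ⟨⟨a1, e1⟩, ⟨a2, e2⟩, ⟨a3, e3⟩⟩ := And.intro (mem u h1) (And.intro (mem v h2) (mem w h3))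
      obtain rfl : c' = c := hcu _ ⟨hc', a1, a2, a3⟩
      refine .inr ⟨hne, ?_⟩
      -- A block of another copy could share only points `Ah`, but three of these force the old
      -- block `oldA k`.
      by_cases hi : i = i'
      · rw [hi]
      · exact absurd (hcu _ ⟨hA, e1.resolve_left hi, e2.resolve_left hi, e3.resolve_left hi⟩).symm hne
    · exfalso
      rcases u with x1 | g1 <;> rcases v with x2 | g2 <;> rcases w with x3 | g3 <;>
        simp [liftPt] at h1 h2 h3 huv huw hvw <;> grind
    · exfalso
      have := zmodThree_facts i'
      rcases u with x1 | g1 <;> rcases v with x2 | g2 <;> rcases w with x3 | g3 <;>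
        simp [liftPt] at h1 h2 h3 huv huw hvw <;> grind
    · exfalso
      have := zmodThree_facts i'
      have h4 : ∀ q ∈ P α, ∀ x y z, x ≠ y → x ≠ z → y ≠ z → x ∈ q → y ∈ q → z ∉ q := by
        intro q hq x y z hxy hxz hyz hx hy hz
        rw [hP.eq_of_mem hα' hq hx hy hxy] at hz
        simp at hz
        tauto
      rcases u with x1 | g1 <;> rcases v with x2 | g2 <;> rcases w with x3 | g3 <;>
        simp [liftPt] at h1 h2 h3 huv huw hvw
      have h5 := h4 p hp x1 x2 x3 huv huw hvw
      have h6 := h4 p' hp' x1 x2 x3 huv huw hvw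
      grind
  by_cases hcA : c = oldA k
  · refine ⟨newA k, ⟨(mem_hananiBlocks_iff hP).2 (.inl rfl), ?_, ?_, ?_⟩, ?_⟩
    · obtain ⟨g, rfl⟩ := mem_oldA.1 (hcA ▸ hu); exact specialPt_mem_newA
    · obtain ⟨g, rfl⟩ := mem_oldA.1 (hcA ▸ hv); exact specialPt_mem_newA
    · obtain ⟨g, rfl⟩ := mem_oldA.1 (hcA ▸ hw); exact specialPt_mem_newA
    · rintro b ⟨hb, h1, h2, h3⟩
      rcases key b hb h1 h2 h3 with h | h
      exacts [h.2, absurd hcA h.1]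
  · refine ⟨copyBlock i c, ⟨(mem_hananiBlocks_iff hP).2 (.inr (.inl ⟨i, c, hc, hcA, rfl⟩)),
      Finset.mem_image_of_mem _ hu, Finset.mem_image_of_mem _ hv, Finset.mem_image_of_mem _ hw⟩, ?_⟩
    rintro b ⟨hb, h1, h2, h3⟩
    rcases key b hb h1 h2 h3 with h | h
    exacts [absurd h.1 hcA, h.2]

/-- Given `Ah`, two coordinates in different copies determine the third by the sum condition. -/
lemma inUniqueBlock_special (hP : IsPairSystem k P) (h : Fin 4) {i j : ZMod 3} (hij : i ≠ j)
    (x y : ZMod (12 * k + 10)) :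
    InUniqueBlock (hananiBlocks k B P) (specialPt h) (copyPt i x) (copyPt j y) := by
  suffices key : ∃ z t, ∀ h' z' t', specialPt h ∈ mixedBlock h' z' t' ∧
      copyPt i x ∈ mixedBlock h' z' t' ∧ copyPt j y ∈ mixedBlock h' z' t' ↔
        h' = h ∧ z' = z ∧ t' = t by
    obtain ⟨z, t, key⟩ := key
    refine ⟨mixedBlock h z t, ⟨(mem_hananiBlocks_iff hP).2 (.inr (.inr (.inl ⟨h, z, t, rfl⟩))),
      (key h z t).2 ⟨rfl, rfl, rfl⟩⟩, ?_⟩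
    rintro b ⟨hb, h1, h2, h3⟩
    rcases (mem_hananiBlocks_iff hP).1 hb with rfl | ⟨i', c', hc', hne, rfl⟩ | ⟨h', z', t', rfl⟩ |
      ⟨i', b₁, b₂, d, hd, rfl⟩ | ⟨i', α, p, p', hα, hα', hp, hp', rfl⟩
    · simp at h2
    · simp at h2 h3
      exact absurd (h2.1.trans h3.1.symm) hij
    · obtain ⟨rfl, rfl, rfl⟩ := (key h' z' t').1 ⟨h1, h2, h3⟩
      rfl
    · simp at h1
    · simp at h1
  have h01 : (0 : ZMod 3) ≠ 1 := by decide
  have h02 : (0 : ZMod 3) ≠ 2 := by decide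
  have h12 : (1 : ZMod 3) ≠ 2 := by decide
  simp only [specialPt_mem_mixedBlock, copyPt_mem_mixedBlock]
  have hi : i = 0 ∨ i = 1 ∨ i = 2 := by decide +revert
  have hj : j = 0 ∨ j = 1 ∨ j = 2 := by decide +revert
  have hc : (i = 0 ∧ j = 1) ∨ (i = 1 ∧ j = 0) ∨ (i = 0 ∧ j = 2) ∨ (i = 2 ∧ j = 0) ∨
      (i = 1 ∧ j = 2) ∨ (i = 2 ∧ j = 1) := by grind
  rcases hc with ⟨rfl, rfl⟩ | ⟨rfl, rfl⟩ | ⟨rfl, rfl⟩ | ⟨rfl, rfl⟩ | ⟨rfl, rfl⟩ | ⟨rfl, rfl⟩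
  · exact ⟨x, y, by grind⟩
  · exact ⟨y, x, by grind⟩
  · exact ⟨x, -(h.val + x + y), by grind⟩
  · exact ⟨y, -(h.val + x + y), by grind⟩
  · exact ⟨-(h.val + x + y), x, by grind⟩
  · exact ⟨-(h.val + x + y), y, by grind⟩

end Triples

/-! ### Steiner property: the other triples, and the conclusion. -/

section Triples

variable {k : ℕ} {B : Set (Finset (OldPt k))} {P : ℕ → Set (Finset (ZMod (12 * k + 10)))}

/-- The two points of a block of the fourth kind in the same copy determine its parameters. -/
lemma spreadBlock_params {i i' : ZMod 3} {x y b₁ b₂ : ZMod (12 * k + 10)} {d d' : ℕ}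
    (hd : d ≤ 2 * k) (hd' : d' ≤ 2 * k)
    (hxy : y - x = ((2 * d + 1 : ℕ) : ZMod (12 * k + 10)))
    (hx : copyPt i x ∈ spreadBlock i' b₁ b₂ d') (hy : copyPt i y ∈ spreadBlock i' b₁ b₂ d') :
    i = i' ∧ d = d' ∧ b₁ = x + d - spreadOffset k i := by
  have hne : x ≠ y := by
    rintro rfl
    rw [sub_self] at hxy
    exact absurd (natCast_inj_of_lt (k := k) (a := 0) (b := 2 * d + 1) (by omega) (by omega)
      (by simpa using hxy)) (by omega)
  push_cast at hxy
  simp only [copyPt_mem_spreadBlock] at hx hy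
  have hf := zmodThree_facts i'
  obtain rfl : i = i' := by grind
  have hx' : x = b₁ + spreadOffset k i - d' ∨ x = b₁ + spreadOffset k i + 1 + d' := by grind
  have hy' : y = b₁ + spreadOffset k i - d' ∨ y = b₁ + spreadOffset k i + 1 + d' := by grind
  have hor : x = b₁ + spreadOffset k i - d' ∧ y = b₁ + spreadOffset k i + 1 + d' := by
    rcases hx' with hx' | hx' <;> rcases hy' with hy' | hy'
    · exact absurd (hx'.trans hy'.symm) hne
    · exact ⟨hx', hy'⟩
    -- The reversed orientation would make `(2d + 1) + (2d' + 1)` vanish, but this number lies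
    -- between `2` and `8k + 2`.
    · exfalso
      have : ((2 * d + 1 + (2 * d' + 1) : ℕ) : ZMod (12 * k + 10)) = (0 : ℕ) := by
        push_cast
        rw [← hxy, hx', hy']
        ring
      exact absurd (natCast_inj_of_lt (by omega) (by omega) this) (by omega)
    · exact absurd (hx'.trans hy'.symm) hne
  have hdd : d = d' := by
    have : ((2 * d + 1 : ℕ) : ZMod (12 * k + 10)) = (2 * d' + 1 : ℕ) := by
      push_cast
      rw [← hxy, hor.1, hor.2]
      ring
    have := natCast_inj_of_lt (by omega) (by omega) this
    omega
  subst hdd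
  exact ⟨rfl, rfl, by rw [hor.1]; ring⟩

/-- The difference puts `{x, y}` into one of the first `4k + 2` systems, which excludes the fifth
kind; in the fourth kind `x`, `y` fix `i`, `d`, `b₁`, and `z` fixes `b₂`. -/
lemma inUniqueBlock_spread (hP : IsPairSystem k P) {i j : ZMod 3} (hij : j ≠ i)
    {x y : ZMod (12 * k + 10)} (z : ZMod (12 * k + 10)) {d : ℕ} (hd : d ≤ 2 * k)
    (hxy : y - x = ((2 * d + 1 : ℕ) : ZMod (12 * k + 10))) :
    InUniqueBlock (hananiBlocks k B P) (copyPt i x) (copyPt i y) (copyPt j z) := by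
  have hne : x ≠ y := by
    rintro rfl
    rw [sub_self] at hxy
    exact absurd (natCast_inj_of_lt (k := k) (a := 0) (b := 2 * d + 1) (by omega) (by omega)
      (by simpa using hxy)) (by omega)
  have hf := zmodThree_facts i
  obtain ⟨α, hα, hαp⟩ := (hP.short x y).2 ⟨d, hd, .inl hxy⟩
  set b₁ : ZMod (12 * k + 10) := x + d - spreadOffset k i with hb₁
  -- The point `jz` is the one with `b₂` if `j = i + 1`, and the one with `b₃ = -(b₁ + b₂)` if `j =
  -- i + 2`.
  set b₂ : ZMod (12 * k + 10) := if j = i + 1 then z else -(b₁ + z) with hb₂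
  push_cast at hxy
  refine ⟨spreadBlock i b₁ b₂ d, ⟨(mem_hananiBlocks_iff hP).2
    (.inr (.inr (.inr (.inl ⟨i, b₁, b₂, d, hd, rfl⟩)))), ?_, ?_, ?_⟩, ?_⟩
  · simp only [copyPt_mem_spreadBlock, true_and]
    exact .inr (.inl (.inl (by rw [hb₁]; ring)))
  · simp only [copyPt_mem_spreadBlock, true_and]
    exact .inr (.inl (.inr (by rw [hb₁]; linear_combination hxy)))
  · simp only [copyPt_mem_spreadBlock]
    rcases zmodThree_cases hij with rfl | rfl
    · simp [hb₂]
    · left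
      rw [hb₂, if_neg hf.2.2.1.symm]
      exact ⟨rfl, by ring⟩
  · rintro b ⟨hb, h1, h2, h3⟩
    rcases (mem_hananiBlocks_iff hP).1 hb with rfl | ⟨i', c', hc', hne, rfl⟩ | ⟨h', z', t', rfl⟩ |
      ⟨i', b₁', b₂', d', hd', rfl⟩ | ⟨i', α', p, p', hα₁, hα₂, hp, hp', rfl⟩
    · simp at h1
    · simp at h1 h3
      exact absurd (h3.1.trans h1.1.symm) hij
    · simp at h1 h2
      grind
    · obtain ⟨rfl, rfl, e₁⟩ := spreadBlock_params hd hd' (by exact_mod_cast hxy) h1 h2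
      simp only [copyPt_mem_spreadBlock] at h3
      rw [e₁] at h3 ⊢
      have e₂ : b₂' = b₂ := by
        rcases zmodThree_cases hij with rfl | rfl
        · rw [hb₂, if_pos rfl]
          grind
        · rw [hb₂, if_neg hf.2.2.1.symm]
          have : z = -(b₁ + b₂') := by grind
          rw [this]; ring
      rw [e₂]
    · exfalso
      have hmem : ({x, y} : Finset _) ∈ P α' := by
        simp only [copyPt_mem_pairBlock] at h1 h2
        have hf' := zmodThree_facts i'
        have : (x ∈ p ∧ y ∈ p) ∨ (x ∈ p' ∧ y ∈ p') := by grind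
        rcases this with h | h
        · rwa [← hP.eq_of_mem hα₂ hp h.1 h.2 hne]
        · rwa [← hP.eq_of_mem hα₂ hp' h.1 h.2 hne]
      have := (hP.once _ (Finset.card_pair hne)).unique ⟨hα₂, hmem⟩ ⟨by omega, hαp⟩
      omega

/-- Here the index of `{x, y}` excludes the fourth kind. The partner is the pair of the same `P α`
through `z`; which of the two pairs comes first depends on the cyclic order of the copies. -/
lemma inUniqueBlock_pairs (hP : IsPairSystem k P) {i j : ZMod 3} (hij : j ≠ i)
    {x y : ZMod (12 * k + 10)} (hxy : x ≠ y) (z : ZMod (12 * k + 10)) {α : ℕ}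
    (hα : 4 * k + 2 ≤ α) (hα' : α ≤ 12 * k + 8) (hp : {x, y} ∈ P α) :
    InUniqueBlock (hananiBlocks k B P) (copyPt i x) (copyPt i y) (copyPt j z) := by
  have hf := zmodThree_facts i
  obtain ⟨q, ⟨hq, hzq⟩, hqu⟩ := hP.factor α hα' z
  have key : ∀ b ∈ hananiBlocks k B P, copyPt i x ∈ b → copyPt i y ∈ b → copyPt j z ∈ b →
      b = if j = i + 1 then pairBlock i {x, y} q else pairBlock j q {x, y} := by
    intro b hb h1 h2 h3
    rcases (mem_hananiBlocks_iff hP).1 hb with rfl | ⟨i', c', hc', hne, rfl⟩ | ⟨h', z', t', rfl⟩ |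
      ⟨i', b₁', b₂', d', hd', rfl⟩ | ⟨i', α', p, p', hα₁, hα₂, hpα, hpα', rfl⟩
    · simp at h1
    · simp at h1 h3
      exact absurd (h3.1.trans h1.1.symm) hij
    · simp at h1 h2
      grind
    · exfalso
      simp only [copyPt_mem_spreadBlock] at h1 h2 h3
      have hf' := zmodThree_facts i'
      obtain rfl : i = i' := by grind
      have h1' : x = b₁' + spreadOffset k i - d' ∨ x = b₁' + spreadOffset k i + 1 + d' := by grind
      have h2' : y = b₁' + spreadOffset k i - d' ∨ y = b₁' + spreadOffset k i + 1 + d' := by grind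
      have hshort : ∃ α < 4 * k + 2, {x, y} ∈ P α := by
        rw [hP.short]
        refine ⟨d', hd', ?_⟩
        push_cast
        rcases h1' with h1' | h1' <;> rcases h2' with h2' | h2'
        · exact absurd (h1'.trans h2'.symm) hxy
        · left; rw [h1', h2']; ring
        · right; rw [h1', h2']; ring
        · exact absurd (h1'.trans h2'.symm) hxy
      obtain ⟨β, hβ, hβp⟩ := hshort
      have := (hP.once _ (Finset.card_pair hxy)).unique ⟨hα', hp⟩ ⟨by omega, hβp⟩
      omega
    · simp only [copyPt_mem_pairBlock] at h1 h2 h3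
      have hf' := zmodThree_facts i'
      by_cases hi : i = i'
      · subst hi
        obtain rfl : p = {x, y} := hP.eq_of_mem hα₂ hpα (by grind) (by grind) hxy
        obtain rfl := (hP.once _ (Finset.card_pair hxy)).unique ⟨hα', hp⟩ ⟨hα₂, hpα⟩
        obtain rfl : j = i + 1 := by grind
        rw [if_pos rfl, hqu p' ⟨hpα', by grind⟩]
      · obtain rfl : p' = {x, y} := hP.eq_of_mem hα₂ hpα' (by grind) (by grind) hxy
        obtain rfl := (hP.once _ (Finset.card_pair hxy)).unique ⟨hα', hp⟩ ⟨hα₂, hpα'⟩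
        obtain rfl : i = i' + 1 := by grind
        obtain rfl : j = i' := by grind
        rw [if_neg (by grind), hqu p ⟨hpα, by grind⟩]
  refine ⟨_, ⟨(mem_hananiBlocks_iff hP).2 (.inr (.inr (.inr (.inr ?_)))), ?_⟩,
    fun b hb => key b hb.1 hb.2.1 hb.2.2.1 hb.2.2.2⟩
  · split_ifs with h
    · exact ⟨i, α, _, _, hα, hα', hp, hq, rfl⟩
    · exact ⟨j, α, _, _, hα, hα', hq, hp, rfl⟩
  · split_ifs with h
    · simp [h, hzq]
    · obtain rfl := (zmodThree_cases hij).resolve_left h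
      simp [hf, hzq]

lemma inUniqueBlock_pair (hP : IsPairSystem k P) {i j : ZMod 3} (hij : j ≠ i)
    {x y : ZMod (12 * k + 10)} (hxy : x ≠ y) (z : ZMod (12 * k + 10)) :
    InUniqueBlock (hananiBlocks k B P) (copyPt i x) (copyPt i y) (copyPt j z) := by
  obtain ⟨α, ⟨hα, hp⟩, -⟩ := hP.once _ (Finset.card_pair hxy)
  rcases Nat.lt_or_ge α (4 * k + 2) with h | h
  · obtain ⟨d, hd, h | h⟩ := (hP.short x y).1 ⟨α, h, hp⟩
    · exact inUniqueBlock_spread hP hij z hd h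
    · exact (inUniqueBlock_spread hP hij z hd h).swap_left
  · exact inUniqueBlock_pairs hP hij hxy z h hα hp

/-- Let `s` be the representative of the coordinate sum. The third kind requires `s = -h`, that is
`s = 0` or `s ≥ 12k + 7`. The fourth kind requires `s` to be `spreadOffset k i - d` or `spreadOffset
k i + 1 + d`, which sweeps the interval from `i(4k + 2) + 1` to `(i + 1)(4k + 2)` once. -/
lemma inUniqueBlock_transversal (hP : IsPairSystem k P) (f : ZMod 3 → ZMod (12 * k + 10)) :
    InUniqueBlock (hananiBlocks k B P) (copyPt 0 (f 0)) (copyPt 1 (f 1)) (copyPt 2 (f 2)) := by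
  obtain ⟨s, hs, hsf⟩ : ∃ s < 12 * k + 10, (s : ZMod (12 * k + 10)) = f 0 + f 1 + f 2 :=
    ⟨_, ZMod.val_lt (f 0 + f 1 + f 2), by simp⟩
  have hsum : ∀ i, (s : ZMod (12 * k + 10)) = f i + f (i + 1) + f (i + 2) := by
    intro i
    have hi : i = 0 ∨ i = 1 ∨ i = 2 := by decide +revert
    rw [hsf]
    rcases hi with rfl | rfl | rfl
    · simp
    · rw [show (1 + 1 : ZMod 3) = 2 by decide, show (1 + 2 : ZMod 3) = 0 by decide]; ring
    · rw [show (2 + 1 : ZMod 3) = 0 by decide, show (2 + 2 : ZMod 3) = 1 by decide]; ring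
  have hall : ∀ b : Finset (NewPt k), (copyPt 0 (f 0) ∈ b ∧ copyPt 1 (f 1) ∈ b ∧
      copyPt 2 (f 2) ∈ b) ↔ ∀ i, copyPt i (f i) ∈ b := by
    intro b
    refine ⟨fun h i => ?_, fun h => ⟨h 0, h 1, h 2⟩⟩
    have hi : i = 0 ∨ i = 1 ∨ i = 2 := by decide +revert
    rcases hi with rfl | rfl | rfl
    exacts [h.1, h.2.1, h.2.2]
  have hoff : ∀ (i : ZMod 3) (d : ℕ), d ≤ 2 * k → spreadOffset k i + 1 + d < 12 * k + 10 := by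
    intro i d hd
    have := ZMod.val_lt i
    unfold spreadOffset
    have : i.val = 0 ∨ i.val = 1 ∨ i.val = 2 := by omega
    rcases this with h | h | h <;> rw [h] <;> omega
  have hoffd : ∀ (i : ZMod 3) (d : ℕ), d ≤ 2 * k → d < spreadOffset k i := by
    intro i d hd
    unfold spreadOffset
    omega
  -- The only possible `b₁` for the index `i`; then `f i - b₁` is the sum `s`.
  let β : ZMod 3 → ZMod (12 * k + 10) := fun i => -(f (i + 1) + f (i + 2))
  have key : ∀ b, b ∈ hananiBlocks k B P ∧ (∀ i, copyPt i (f i) ∈ b) ↔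
      (∃ h : Fin 4, (h.val + s = 0 ∨ h.val + s = 12 * k + 10) ∧ b = mixedBlock h (f 0) (f 1)) ∨
      ∃ i d, d ≤ 2 * k ∧ (s + d = spreadOffset k i ∨ s = spreadOffset k i + 1 + d) ∧
        b = spreadBlock i (β i) (f (i + 1)) d := by
    intro b
    constructor
    · rintro ⟨hb, h⟩
      rcases (mem_hananiBlocks_iff hP).1 hb with rfl | ⟨i, c, hc, hne, rfl⟩ | ⟨g, x, y, rfl⟩ |
        ⟨i, b₁, b₂, d, hd, rfl⟩ | ⟨i, α, p, p', hα₁, hα₂, hpα, hpα', rfl⟩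
      · simpa using h 0
      · exfalso
        have h0 := h i
        have h1 := h (i + 1)
        have := zmodThree_facts i
        simp at h0 h1
      · left
        have h01 : (0 : ZMod 3) ≠ 1 := by decide
        have h02 : (0 : ZMod 3) ≠ 2 := by decide
        have h12 : (1 : ZMod 3) ≠ 2 := by decide
        have h0 := h 0
        have h1 := h 1
        have h2 := h 2
        simp only [copyPt_mem_mixedBlock] at h0 h1 h2
        obtain rfl : f 0 = x := by grind
        obtain rfl : f 1 = y := by grind
        have h2 : f 2 = -(g.val + f 0 + f 1) := by grind
        refine ⟨g, ?_, rfl⟩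
        have hz : ((g.val + s : ℕ) : ZMod (12 * k + 10)) = 0 := by
          push_cast
          rw [hsf, h2]; ring
        rw [ZMod.natCast_eq_zero_iff] at hz
        obtain ⟨c, hc⟩ := hz
        have : c < 2 := by
          by_contra hcon
          have : (12 * k + 10) * 2 ≤ (12 * k + 10) * c := Nat.mul_le_mul_left _ (by omega)
          omega
        obtain rfl | rfl : c = 0 ∨ c = 1 := by omega
        all_goals omega
      · right
        have hf := zmodThree_facts i
        have h0 := h i
        have h1 := h (i + 1)
        have h2 := h (i + 2)
        simp only [copyPt_mem_spreadBlock] at h0 h1 h2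
        have h0' : f i = b₁ + spreadOffset k i - d ∨ f i = b₁ + spreadOffset k i + 1 + d := by grind
        obtain rfl : f (i + 1) = b₂ := by grind
        have h2' : f (i + 2) = -(b₁ + f (i + 1)) := by grind
        refine ⟨i, d, hd, ?_, ?_⟩
        · have l1 := hoff i d hd
          have l2 := hoffd i d hd
          rcases h0' with h0' | h0'
          · left
            have : s = spreadOffset k i - d := by
              refine natCast_inj_of_lt hs (by omega) ?_
              rw [Nat.cast_sub l2.le, hsum i, h2', h0']
              ring
            omega
          · right
            refine natCast_inj_of_lt hs l1 ?_
            push_cast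
            rw [hsum i, h2', h0']; ring
        · congr 1
          rw [show β i = -(f (i + 1) + f (i + 2)) from rfl, h2']; ring
      · exfalso
        have := h (i + 2)
        have hf := zmodThree_facts i
        simp only [copyPt_mem_pairBlock] at this
        grind
    · rintro (⟨g, hg, rfl⟩ | ⟨i, d, hd, hsd, rfl⟩)
      · refine ⟨(mem_hananiBlocks_iff hP).2 (.inr (.inr (.inl ⟨g, _, _, rfl⟩))), ?_⟩
        rw [← hall]
        refine ⟨by simp, by simp, ?_⟩
        have hz : ((g.val + s : ℕ) : ZMod (12 * k + 10)) = 0 := by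
          rcases hg with hg | hg <;> rw [hg]
          · simp
          · exact ZMod.natCast_self _
        push_cast at hz
        simp only [copyPt_mem_mixedBlock]
        exact .inr (.inr ⟨trivial, by rw [hsf] at hz; linear_combination hz⟩)
      · refine ⟨(mem_hananiBlocks_iff hP).2 (.inr (.inr (.inr (.inl ⟨i, _, _, d, hd, rfl⟩)))), ?_⟩
        intro j
        simp only [copyPt_mem_spreadBlock]
        by_cases hj : j = i
        · subst hj
          refine .inr (.inl ⟨rfl, ?_⟩)
          have e := hsum j
          rcases hsd with hsd | hsd <;> have hsd := congrArg (Nat.cast (R := ZMod (12 * k + 10))) hsd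
          · left
            push_cast at hsd
            linear_combination hsd - e
          · right
            push_cast at hsd
            linear_combination hsd - e
        · rcases zmodThree_cases hj with rfl | rfl
          · exact .inr (.inr ⟨rfl, rfl⟩)
          · exact .inl ⟨rfl, by simp only [β]; ring⟩
  unfold InUniqueBlock
  simp only [hall, key]
  refine existsUnique_of_exists_of_unique ?_ ?_
  · by_cases h0 : s = 0
    · exact ⟨_, .inl ⟨0, .inl (by simp [h0]), rfl⟩⟩
    by_cases h1 : 12 * k + 7 ≤ s
    · exact ⟨_, .inl ⟨⟨12 * k + 10 - s, by omega⟩, .inr (by simp only; omega), rfl⟩⟩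
    obtain ⟨i, hi, hi'⟩ : ∃ i : ZMod 3, i.val * (4 * k + 2) < s ∧ s ≤ (i.val + 1) * (4 * k + 2) := by
      by_cases h2 : s ≤ 4 * k + 2
      · exact ⟨0, by rw [show (0 : ZMod 3).val = 0 from rfl]; omega⟩
      by_cases h3 : s ≤ 8 * k + 4
      · exact ⟨1, by rw [show (1 : ZMod 3).val = 1 from rfl]; omega⟩
      · exact ⟨2, by rw [show (2 : ZMod 3).val = 2 from rfl]; omega⟩
    rw [add_mul] at hi'
    rcases Nat.lt_or_ge (spreadOffset k i) s with h | h
    · exact ⟨_, .inr ⟨i, s - (spreadOffset k i + 1), by unfold spreadOffset; omega, by omega, rfl⟩⟩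
    · exact ⟨_, .inr ⟨i, spreadOffset k i - s, by unfold spreadOffset; omega, by omega, rfl⟩⟩
  · have hi3 : ∀ i : ZMod 3, i.val = 0 ∨ i.val = 1 ∨ i.val = 2 := by decide
    rintro b c (⟨g, hg, rfl⟩ | ⟨i, d, hd, hsd, rfl⟩) (⟨g', hg', rfl⟩ | ⟨i', d', hd', hsd', rfl⟩)
    · congr 1
      omega
    · exfalso
      unfold spreadOffset at hsd'
      rcases hi3 i' with h | h | h <;> rw [h] at hsd' <;> omega
    · exfalso
      unfold spreadOffset at hsd
      rcases hi3 i with h | h | h <;> rw [h] at hsd <;> omega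
    · unfold spreadOffset at hsd hsd'
      have : i.val = i'.val ∧ d = d' := by
        rcases hi3 i with h | h | h <;> rcases hi3 i' with h' | h' | h' <;>
          rw [h] at hsd <;> rw [h'] at hsd' <;> omega
      obtain rfl := ZMod.val_injective 3 this.1
      rw [this.2]

theorem isSQS_hananiBlocks (hP : IsPairSystem k P) (hB : IsSQS (12 * k + 14) B)
    (hA : oldA k ∈ B) : IsSQS (3 * (12 * k + 14) - 8) (hananiBlocks k B P) := by
  rw [isSQS_iff_inUniqueBlock]
  refine ⟨?_, fun b => card_of_mem_hananiBlocks hP hB.2.1, ?_⟩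
  · simp [NewPt, ZMod.card]
    omega
  have hsp : ∀ (i : ZMod 3) (h : Fin 4), (.inr h : NewPt k) = liftPt i (.inr h) := fun _ _ => rfl
  have hcp : ∀ (i : ZMod 3) x, (.inl (i, x) : NewPt k) = liftPt i (.inl x) := fun _ _ => rfl
  have lift : ∀ (i : ZMod 3) (u v w : OldPt k), liftPt i u ≠ liftPt i v → liftPt i u ≠ liftPt i w →
      liftPt i v ≠ liftPt i w →
      InUniqueBlock (hananiBlocks k B P) (liftPt i u) (liftPt i v) (liftPt i w) :=
    fun i u v w h1 h2 h3 => inUniqueBlock_lift hP hB hA i (ne_of_apply_ne _ h1)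
      (ne_of_apply_ne _ h2) (ne_of_apply_ne _ h3)
  have A1 : ∀ h i j x y, (.inl (i, x) : NewPt k) ≠ .inl (j, y) →
      InUniqueBlock (hananiBlocks k B P) (.inr h) (.inl (i, x)) (.inl (j, y)) := by
    intro h i j x y hne
    by_cases hij : i = j
    · subst hij
      exact lift i (.inr h) (.inl x) (.inl y) (by simp [liftPt, copyPt, specialPt])
        (by simp [liftPt, copyPt, specialPt]) hne
    · exact inUniqueBlock_special hP h hij x y
  have A2 : ∀ g h i x, g ≠ h →
      InUniqueBlock (hananiBlocks k B P) (.inr g) (.inr h) (.inl (i, x)) := fun g h i x hne =>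
    lift i (.inr g) (.inr h) (.inl x) (by simpa [liftPt, copyPt, specialPt] using hne)
      (by simp [liftPt, copyPt, specialPt]) (by simp [liftPt, copyPt, specialPt])
  have A3 : ∀ i j x y z, (x ≠ y ∧ (i = j → z ≠ x ∧ z ≠ y)) →
      InUniqueBlock (hananiBlocks k B P) (.inl (i, x)) (.inl (i, y)) (.inl (j, z)) := by
    rintro i j x y z ⟨hxy, h⟩
    by_cases hij : j = i
    · subst hij
      refine lift j (.inl x) (.inl y) (.inl z) ?_ ?_ ?_ <;> simp [liftPt] <;> grind
    · exact inUniqueBlock_pair hP hij hxy z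
  rintro (⟨i, x⟩ | f) (⟨j, y⟩ | g) (⟨l, z⟩ | h) huv huw hvw
  · by_cases hij : i = j
    · subst hij
      exact A3 i l x y z (by grind)
    by_cases hil : i = l
    · subst hil
      exact (A3 i j x z y (by grind)).swap_right
    by_cases hjl : j = l
    · subst hjl
      exact (A3 j i y z x (by grind)).swap_right.swap_left
    let f : ZMod 3 → ZMod (12 * k + 10) := fun t => if t = i then x else if t = j then y else z
    have hfi : f i = x := by simp [f]
    have hfj : f j = y := by simp [f, Ne.symm hij]
    have hfl : f l = z := by simp [f, Ne.symm hil, Ne.symm hjl]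
    have key := inUniqueBlock_transversal (B := B) hP f
    rw [← hfi, ← hfj, ← hfl]
    have hc : (i = 0 ∧ j = 1 ∧ l = 2) ∨ (i = 0 ∧ j = 2 ∧ l = 1) ∨ (i = 1 ∧ j = 0 ∧ l = 2) ∨
        (i = 1 ∧ j = 2 ∧ l = 0) ∨ (i = 2 ∧ j = 0 ∧ l = 1) ∨ (i = 2 ∧ j = 1 ∧ l = 0) := by
      have h3 : ∀ i : ZMod 3, i = 0 ∨ i = 1 ∨ i = 2 := by decide
      have hi := h3 i
      have hj := h3 j
      have hl := h3 l
      grind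
    rcases hc with ⟨rfl, rfl, rfl⟩ | ⟨rfl, rfl, rfl⟩ | ⟨rfl, rfl, rfl⟩ | ⟨rfl, rfl, rfl⟩ |
      ⟨rfl, rfl, rfl⟩ | ⟨rfl, rfl, rfl⟩
    · exact key
    · exact key.swap_right
    · exact key.swap_left
    · exact key.swap_left.swap_right
    · exact key.swap_right.swap_left
    · exact key.swap_right.swap_left.swap_right
  · exact (A1 h i j x y huv).swap_left.swap_right
  · exact (A1 g i l x z huw).swap_left
  · exact (A2 g h i x (by simpa using hvw)).swap_right.swap_left
  · exact A1 f j l y z hvw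
  · exact (A2 f h j y (by simpa using huw)).swap_right
  · exact A2 f g l z (by simpa using huv)
  · exact lift 0 (.inr f) (.inr g) (.inr h) huv huw hvw

end Triples

/-! ### Decomposition of the construction into circuits, and their connection. -/

section Parts

/-- A finite set carries an operation whose triples `(a, b, f a b)` are closed under rotation. -/
lemma exists_rotation_closed_op {T : Type*} {s : Set T} (hs : s.Finite) (hne : s.Nonempty) :
    ∃ f : T → T → T, ∀ a ∈ s, ∀ b ∈ s, f a b ∈ s ∧ f b (f a b) = a ∧ f (f a b) a = b := by
  classical
  have := hs.to_subtype
  have := hne.to_subtype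
  obtain ⟨n, hn⟩ := Nat.exists_eq_succ_of_ne_zero (Nat.card_pos (α := s)).ne'
  let e : s ≃ ZMod (n + 1) := Finite.equivFinOfCardEq hn
  -- The triples are the solutions of `a + b + c = 0` in a cyclic group, a symmetric condition; the
  -- value outside `s` is a default.
  refine ⟨fun a b => if h : a ∈ s ∧ b ∈ s then e.symm (-(e ⟨a, h.1⟩ + e ⟨b, h.2⟩)) else a, ?_⟩
  intro a ha b hb
  simp [ha, hb]

variable {k : ℕ} {B : Set (Finset (OldPt k))} {P : ℕ → Set (Finset (ZMod (12 * k + 10)))}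

/-- The blocks of the first two kinds. -/
def copyPart (B : Set (Finset (OldPt k))) : Set (Finset (NewPt k)) :=
  {newA k} ∪ ⋃ i, copyBlock i '' (B \ {oldA k})

lemma copy_eq_of_mem_copyPart {b : Finset (NewPt k)} (hb : b ∈ copyPart B) :
    ∀ i j x y, copyPt i x ∈ b → copyPt j y ∈ b → i = j := by
  rcases hb with rfl | hb
  · simp
  · rw [Set.mem_iUnion] at hb
    obtain ⟨l, c, -, rfl⟩ := hb
    simp
    grind

lemma exists_inl_mem {c : Finset (OldPt k)} (hc : c.card = 4) (hne : c ≠ oldA k) :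
    ∃ x, Sum.inl x ∈ c := by
  by_contra! h
  refine hne (Finset.eq_of_subset_of_card_le ?_ ?_)
  · rintro (x | g) hu
    · exact absurd hu (h x)
    · exact mem_oldA.2 ⟨g, rfl⟩
  · rw [hc]
    exact Finset.card_le_four

lemma isCircuit_copyPart (hB : IsSQS (12 * k + 14) B) (hO : AdmitsOcycle 1 B) (hA : oldA k ∈ B) :
    ∃ h, IsCircuit (copyPart B) {specialPt h} := by
  obtain ⟨N, w, hw⟩ := hO
  obtain ⟨u, hu, v, hv, huv, V, hV⟩ := IsTrail.of_isOcycle hw hB.2.1 hA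
  obtain ⟨g, rfl⟩ := mem_oldA.1 hu
  obtain ⟨h, rfl⟩ := mem_oldA.1 hv
  have T : ∀ i, IsTrail (copyBlock i '' (B \ {oldA k})) (liftPt i '' V) (specialPt h)
      (specialPt g) := fun i => hV.map (liftPt i) (liftPt_injective i)
  have hd : ∀ i j, i ≠ j →
      Disjoint (copyBlock i '' (B \ {oldA k})) (copyBlock j '' (B \ {oldA k})) := by
    intro i j hij
    rw [Set.disjoint_left]
    rintro _ ⟨c, hc, rfl⟩ ⟨c', hc', he⟩
    obtain ⟨x, hx⟩ := exists_inl_mem (hB.2.1 c hc.1) hc.2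
    have : copyPt i x ∈ copyBlock j c' := by rw [he]; simpa using hx
    rw [copyPt_mem_copyBlock] at this
    exact hij this.1
  have hd' : ∀ i, Disjoint (copyBlock i '' (B \ {oldA k})) {newA k} := by
    intro i
    rw [Set.disjoint_singleton_right]
    rintro ⟨c, hc, he⟩
    obtain ⟨x, hx⟩ := exists_inl_mem (hB.2.1 c hc.1) hc.2
    have : copyPt i x ∈ newA k := by rw [← he]; simpa using hx
    simp at this
  have h4 : IsTrail {newA k} _ (specialPt g) (specialPt h) :=
    .single specialPt_mem_newA specialPt_mem_newA (by simpa using huv)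
  -- The points `Ah`, `Ag` belong to all copies, so the walk runs h to g, g to h, h to g, and
  -- returns through `newA k`.
  have key := (((T 0).append (T 1).reverse (hd 0 1 (by decide))).append (T 2)
    (Set.disjoint_union_left.2 ⟨hd 0 2 (by decide), hd 1 2 (by decide)⟩)).append h4
    (by simp only [Set.disjoint_union_left]; exact ⟨⟨hd' 0, hd' 1⟩, hd' 2⟩)
  have e : copyPart B = copyBlock 0 '' (B \ {oldA k}) ∪ copyBlock 1 '' (B \ {oldA k}) ∪
      copyBlock 2 '' (B \ {oldA k}) ∪ {newA k} := by
    rw [copyPart, Set.union_comm]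
    congr 1
    ext b
    simp only [Set.mem_iUnion, Set.mem_union]
    constructor
    · rintro ⟨i, hi⟩
      have h3 : i = 0 ∨ i = 1 ∨ i = 2 := by clear hi; decide +revert
      rcases h3 with rfl | rfl | rfl <;> tauto
    · rintro ((h | h) | h) <;> exact ⟨_, h⟩
  rw [e]
  exact ⟨h, _, _, Set.singleton_subset_iff.2 key.start_mem, key⟩

/-- There is one block for each of the `12k + 10` values of `y`, an even number. -/
lemma isCircuit_mixed (h : Fin 4) (x : ZMod (12 * k + 10)) :
    IsCircuit (Set.range (mixedBlock h x)) {specialPt h, copyPt 0 x} := by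
  classical
  have hinj : Function.Injective (mixedBlock h x) := by
    intro y y' he
    have : copyPt 1 y ∈ mixedBlock h x y' := by rw [← he]; simp
    rw [copyPt_mem_mixedBlock] at this
    have h10 : (1 : ZMod 3) ≠ 0 := by decide
    have h12 : (1 : ZMod 3) ≠ 2 := by decide
    tauto
  have := IsCircuit.of_even (F := Finset.univ.image (mixedBlock h x)) (x := specialPt h)
    (y := copyPt 0 x) (by simp) (by simp) (by simp)
    (by
      rw [Finset.card_image_of_injective _ hinj, Finset.card_univ, ZMod.card]
      exact ⟨6 * k + 5, by ring⟩)
    (Finset.univ_nonempty.image _)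
  simpa using this

lemma isCircuit_spread (i : ZMod 3) (b₁ : ZMod (12 * k + 10)) {d : ℕ} (hd : d ≤ 2 * k) :
    IsCircuit (Set.range fun b₂ => spreadBlock i b₁ b₂ d)
      {copyPt (k := k) i (b₁ + spreadOffset k i - d), copyPt (k := k) i (b₁ + spreadOffset k i + 1 + d)} := by
  classical
  have hf := zmodThree_facts i
  have hinj : Function.Injective fun b₂ => spreadBlock i b₁ b₂ d := by
    intro y y' he
    have : copyPt (i + 1) y ∈ spreadBlock i b₁ y' d := by
      rw [show spreadBlock i b₁ y' d = _ from he.symm]; simp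
    rw [copyPt_mem_spreadBlock] at this
    grind
  have := IsCircuit.of_even (F := Finset.univ.image fun b₂ => spreadBlock i b₁ b₂ d)
    (x := copyPt (k := k) i (b₁ + spreadOffset k i - d)) (y := copyPt (k := k) i (b₁ + spreadOffset k i + 1 + d))
    (by simpa using spread_endpoints_ne hd _) (by simp) (by simp)
    (by
      rw [Finset.card_image_of_injective _ hinj, Finset.card_univ, ZMod.card]
      exact ⟨6 * k + 5, by ring⟩)
    (Finset.univ_nonempty.image _)
  simpa using this

lemma pairBlock_inj {i j : ZMod 3} {p p' q q' : Finset (ZMod (12 * k + 10))} (hp : p.Nonempty)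
    (hp' : p'.Nonempty) (h : pairBlock i p p' = pairBlock j q q') :
    i = j ∧ p = q ∧ p' = q' := by
  have hi := zmodThree_facts i
  have hj := zmodThree_facts j
  have key : ∀ l z, (l = i ∧ z ∈ p ∨ l = i + 1 ∧ z ∈ p') ↔ (l = j ∧ z ∈ q ∨ l = j + 1 ∧ z ∈ q') := by
    intro l z
    rw [← copyPt_mem_pairBlock, h, copyPt_mem_pairBlock]
  obtain ⟨x, hx⟩ := hp
  obtain ⟨y, hy⟩ := hp'
  have h1 := (key i x).1 (.inl ⟨rfl, hx⟩)
  have h2 := (key (i + 1) y).1 (.inr ⟨rfl, hy⟩)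
  obtain rfl : i = j := by grind
  refine ⟨rfl, ?_, ?_⟩
  · ext z
    have := key i z
    grind
  · ext z
    have := key (i + 1) z
    grind

/-- The three blocks of the fifth kind on the pairs `p`, `p'` and `p''` in the three copies. -/
def triangle (p p' p'' : Finset (ZMod (12 * k + 10))) : Set (Finset (NewPt k)) :=
  {pairBlock 0 p p', pairBlock 1 p' p'', pairBlock 2 p'' p}

lemma isCircuit_triangle {p p' p'' : Finset (ZMod (12 * k + 10))} {x y z : ZMod (12 * k + 10)}
    (hx : x ∈ p) (hy : y ∈ p') (hz : z ∈ p'') :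
    IsCircuit (triangle p p' p'') {copyPt 0 x, copyPt 1 y, copyPt 2 z} := by
  have h01 : (0 : ZMod 3) ≠ 1 := by decide
  have h02 : (0 : ZMod 3) ≠ 2 := by decide
  have h12 : (1 : ZMod 3) ≠ 2 := by decide
  have e1 : (0 + 1 : ZMod 3) = 1 := by decide
  have e2 : (1 + 1 : ZMod 3) = 2 := by decide
  have e3 : (2 + 1 : ZMod 3) = 0 := by decide
  refine IsCircuit.of_triangle (fun h => h01 (pairBlock_inj ⟨x, hx⟩ ⟨y, hy⟩ h).1)
    (fun h => h12 (pairBlock_inj ⟨y, hy⟩ ⟨z, hz⟩ h).1)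
    (fun h => h02 (pairBlock_inj ⟨x, hx⟩ ⟨y, hy⟩ h).1) ?_ ?_ ?_ ?_ ?_ ?_ ?_ ?_ ?_ <;>
  simp [*]

open Classical in
/-- The kind of a block: within one copy, with a point `Ah`, in all copies, in two copies. -/
noncomputable def blockKind (b : Finset (NewPt k)) : ℕ :=
  if ∀ i j x y, copyPt i x ∈ b → copyPt j y ∈ b → i = j then 0
  else if ∃ h, specialPt h ∈ b then 1
  else if ∀ i, ∃ x, copyPt i x ∈ b then 2
  else 3

lemma blockKind_copyPart {b : Finset (NewPt k)} (hb : b ∈ copyPart B) : blockKind b = 0 :=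
  if_pos (copy_eq_of_mem_copyPart hb)

lemma blockKind_mixedBlock (h : Fin 4) (x y : ZMod (12 * k + 10)) :
    blockKind (mixedBlock h x y) = 1 := by
  have h01 : (0 : ZMod 3) ≠ 1 := by decide
  rw [blockKind, if_neg, if_pos ⟨h, by simp⟩]
  intro hc
  exact h01 (hc 0 1 x y (by simp) (by simp))

lemma blockKind_spreadBlock (i : ZMod 3) (b₁ b₂ : ZMod (12 * k + 10)) (d : ℕ) :
    blockKind (spreadBlock i b₁ b₂ d) = 2 := by
  rw [blockKind, if_neg, if_neg (by simp), if_pos]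
  · intro j
    by_cases hj : j = i
    · exact ⟨b₁ + spreadOffset k i - d, by simp [hj]⟩
    · rcases zmodThree_cases hj with rfl | rfl
      · exact ⟨b₂, by simp⟩
      · exact ⟨-(b₁ + b₂), by simp only [copyPt_mem_spreadBlock]; tauto⟩
  · intro hc
    exact (zmodThree_facts i).1 (hc (i + 1) i b₂ (b₁ + spreadOffset k i - d) (by simp) (by simp))

lemma blockKind_pairBlock (i : ZMod 3) {p p' : Finset (ZMod (12 * k + 10))} (hp : p.Nonempty)
    (hp' : p'.Nonempty) : blockKind (pairBlock i p p') = 3 := by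
  have hf := zmodThree_facts i
  obtain ⟨x, hx⟩ := hp
  obtain ⟨y, hy⟩ := hp'
  rw [blockKind, if_neg, if_neg (by simp), if_neg]
  · intro hc
    obtain ⟨z, hz⟩ := hc (i + 2)
    rw [copyPt_mem_pairBlock] at hz
    grind
  · intro hc
    exact hf.1 (hc (i + 1) i y x (by simp [hy]) (by simp [hx]))

/-- The index set of the circuits that the construction splits into. -/
abbrev PartIndex (k : ℕ) (P : ℕ → Set (Finset (ZMod (12 * k + 10)))) : Type :=
  Unit ⊕ (Fin 4 × ZMod (12 * k + 10)) ⊕ (ZMod 3 × ZMod (12 * k + 10) × Fin (2 * k + 1)) ⊕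
    {t : Fin (12 * k + 9) × Finset (ZMod (12 * k + 10)) × Finset (ZMod (12 * k + 10)) //
      4 * k + 2 ≤ t.1.val ∧ t.2.1 ∈ P t.1 ∧ t.2.2 ∈ P t.1}

/-- The block sets of the circuits that the construction splits into. -/
def partBlocks (B : Set (Finset (OldPt k))) (P : ℕ → Set (Finset (ZMod (12 * k + 10))))
    (f : ℕ → Finset (ZMod (12 * k + 10)) → Finset (ZMod (12 * k + 10)) →
      Finset (ZMod (12 * k + 10))) : PartIndex k P → Set (Finset (NewPt k))
  | .inl _ => copyPart B
  | .inr (.inl (h, x)) => Set.range (mixedBlock h x)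
  | .inr (.inr (.inl (i, b₁, d))) => Set.range fun b₂ => spreadBlock i b₁ b₂ d
  | .inr (.inr (.inr t)) => triangle t.1.2.1 t.1.2.2 (f t.1.1 t.1.2.1 t.1.2.2)

/-- Points on the circuits that the construction splits into. -/
def partPoints (g : Fin 4) (P : ℕ → Set (Finset (ZMod (12 * k + 10))))
    (f : ℕ → Finset (ZMod (12 * k + 10)) → Finset (ZMod (12 * k + 10)) →
      Finset (ZMod (12 * k + 10))) (r : Finset (ZMod (12 * k + 10)) → ZMod (12 * k + 10)) :
    PartIndex k P → Set (NewPt k)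
  | .inl _ => {specialPt g}
  | .inr (.inl (h, x)) => {specialPt h, copyPt 0 x}
  | .inr (.inr (.inl (i, b₁, d))) =>
    {copyPt (k := k) i (b₁ + spreadOffset k i - (d : ℕ)), copyPt (k := k) i (b₁ + spreadOffset k i + 1 + (d : ℕ))}
  | .inr (.inr (.inr t)) =>
    {copyPt 0 (r t.1.2.1), copyPt 1 (r t.1.2.2), copyPt 2 (r (f t.1.1 t.1.2.1 t.1.2.2))}

/-- The kinds of the blocks in the parts. -/
def partKind : PartIndex k P → ℕ
  | .inl _ => 0
  | .inr (.inl _) => 1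
  | .inr (.inr (.inl _)) => 2
  | .inr (.inr (.inr _)) => 3

variable {f : ℕ → Finset (ZMod (12 * k + 10)) → Finset (ZMod (12 * k + 10)) →
  Finset (ZMod (12 * k + 10))}

lemma IsPairSystem.nonempty (hP : IsPairSystem k P) {α : ℕ} (hα : α ≤ 12 * k + 8)
    {p : Finset (ZMod (12 * k + 10))} (hp : p ∈ P α) : p.Nonempty := by
  rw [← Finset.card_pos, hP.card_eq α hα p hp]
  omega

lemma IsPairSystem.index_eq (hP : IsPairSystem k P) {α β : ℕ} (hα : α ≤ 12 * k + 8)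
    (hβ : β ≤ 12 * k + 8) {p : Finset (ZMod (12 * k + 10))} (hp : p ∈ P α) (hp' : p ∈ P β) :
    α = β :=
  (hP.once p (hP.card_eq α hα p hp)).unique ⟨hα, hp⟩ ⟨hβ, hp'⟩

/-- The kind is read off the block alone, so for disjointness only parts of the same kind have to be
compared. -/
lemma blockKind_of_mem_partBlocks (hP : IsPairSystem k P)
    (hf : ∀ α ≤ 12 * k + 8, ∀ a ∈ P α, ∀ b ∈ P α,
      f α a b ∈ P α ∧ f α b (f α a b) = a ∧ f α (f α a b) a = b)
    {j : PartIndex k P} {b : Finset (NewPt k)} (hb : b ∈ partBlocks B P f j) :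
    blockKind b = partKind j := by
  rcases j with _ | ⟨h, x⟩ | ⟨i, b₁, d⟩ | ⟨⟨α, p, p'⟩, hα, hp, hp'⟩
  · exact blockKind_copyPart hb
  · obtain ⟨y, rfl⟩ := hb
    exact blockKind_mixedBlock h x y
  · obtain ⟨b₂, rfl⟩ := hb
    exact blockKind_spreadBlock i b₁ b₂ d
  · have hα' : α.val ≤ 12 * k + 8 := by omega
    have h1 := hP.nonempty hα' hp
    have h2 := hP.nonempty hα' hp'
    have h3 := hP.nonempty hα' (hf α hα' p hp p' hp').1
    rcases hb with rfl | rfl | rfl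
    exacts [blockKind_pairBlock 0 h1 h2, blockKind_pairBlock 1 h2 h3, blockKind_pairBlock 2 h3 h1]

lemma pairwise_disjoint_partBlocks (hP : IsPairSystem k P)
    (hf : ∀ α ≤ 12 * k + 8, ∀ a ∈ P α, ∀ b ∈ P α,
      f α a b ∈ P α ∧ f α b (f α a b) = a ∧ f α (f α a b) a = b) :
    Pairwise fun j j' => Disjoint (partBlocks B P f j) (partBlocks B P f j') := by
  intro j j' hjj
  rw [Set.disjoint_left]
  intro b hb hb'
  have hk := (blockKind_of_mem_partBlocks hP hf hb).symm.trans (blockKind_of_mem_partBlocks hP hf hb')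
  apply hjj
  rcases j with _ | ⟨h, x⟩ | ⟨i, b₁, d⟩ | ⟨⟨α, p, p'⟩, hα, hp, hp'⟩ <;>
    rcases j' with _ | ⟨h', x'⟩ | ⟨i', b₁', d'⟩ | ⟨⟨β, q, q'⟩, hβ, hq, hq'⟩ <;>
    simp only [partKind, OfNat.ofNat_ne_zero, OfNat.zero_ne_ofNat,
      OfNat.ofNat_ne_one, OfNat.one_ne_ofNat, zero_ne_one, one_ne_zero, Nat.reduceEqDiff] at hk
  · rfl
  · obtain ⟨y, rfl⟩ := hb
    obtain ⟨y', he⟩ := hb'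
    have h1 : specialPt h ∈ mixedBlock h' x' y' := by rw [he]; simp
    have h2 : copyPt 0 x ∈ mixedBlock h' x' y' := by rw [he]; simp
    have h01 : (0 : ZMod 3) ≠ 1 := by decide
    have h02 : (0 : ZMod 3) ≠ 2 := by decide
    rw [specialPt_mem_mixedBlock] at h1
    rw [copyPt_mem_mixedBlock] at h2
    obtain rfl : x = x' := by tauto
    rw [h1]
  · obtain ⟨b₂, rfl⟩ := hb
    obtain ⟨b₂', he⟩ := hb'
    have h1 : copyPt (k := k) i (b₁ + spreadOffset k i - (d : ℕ)) ∈ spreadBlock i' b₁' b₂' d' := by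
      rw [show spreadBlock i' b₁' b₂' d' = _ from he]; simp
    have h2 : copyPt (k := k) i (b₁ + spreadOffset k i + 1 + (d : ℕ)) ∈ spreadBlock i' b₁' b₂' d' := by
      rw [show spreadBlock i' b₁' b₂' d' = _ from he]; simp
    obtain ⟨rfl, hd, e⟩ := spreadBlock_params (d := d) (d' := d') (by omega) (by omega)
      (by push_cast; ring) h1 h2
    obtain rfl := Fin.ext hd
    rw [e]
    congr 5
    ring
  · have hα' : α.val ≤ 12 * k + 8 := by omega
    have hβ' : β.val ≤ 12 * k + 8 := by omega
    have h1 := hP.nonempty hα' hp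
    have h2 := hP.nonempty hα' hp'
    obtain ⟨h3, h4, h5⟩ := hf α hα' p hp p' hp'
    obtain ⟨-, h4', h5'⟩ := hf β hβ' q hq q' hq'
    have h3' := hP.nonempty hα' h3
    have h01 : (0 : ZMod 3) ≠ 1 := by decide
    have h02 : (0 : ZMod 3) ≠ 2 := by decide
    have h12 : (1 : ZMod 3) ≠ 2 := by decide
    suffices h : α = β ∧ p = q ∧ p' = q' by
      obtain ⟨rfl, rfl, rfl⟩ := h
      rfl
    dsimp only at *
    rcases hb with rfl | rfl | rfl
    · rcases hb' with hb' | hb' | hb' <;> obtain ⟨hi, e1, e2⟩ := pairBlock_inj h1 h2 hb'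
      · exact ⟨Fin.ext (hP.index_eq hα' hβ' hp (e1 ▸ hq)), e1, e2⟩
      · exact absurd hi h01
      · exact absurd hi h02
    · rcases hb' with hb' | hb' | hb' <;> obtain ⟨hi, e1, e2⟩ := pairBlock_inj h2 h3' hb'
      · exact absurd hi h01.symm
      -- Two consecutive members of a triple determine the third by the rotation identities of `f`.
      · obtain rfl := Fin.ext (hP.index_eq hα' hβ' hp' (e1 ▸ hq'))
        exact ⟨rfl, by rw [← h4, ← h4', e1, ← e2, e1], e1⟩
      · exact absurd hi h12
    · rcases hb' with hb' | hb' | hb' <;> obtain ⟨hi, e1, e2⟩ := pairBlock_inj h3' h1 hb'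
      · exact absurd hi h02.symm
      · exact absurd hi h12.symm
      · obtain rfl := Fin.ext (hP.index_eq hα' hβ' hp (e2 ▸ hq))
        exact ⟨rfl, e2, by rw [← h5, ← h5', e1, e2]⟩

lemma iUnion_partBlocks (hP : IsPairSystem k P)
    (hf : ∀ α ≤ 12 * k + 8, ∀ a ∈ P α, ∀ b ∈ P α,
      f α a b ∈ P α ∧ f α b (f α a b) = a ∧ f α (f α a b) a = b) :
    ⋃ j, partBlocks B P f j = hananiBlocks k B P := by
  ext b
  rw [Set.mem_iUnion, mem_hananiBlocks_iff hP]
  constructor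
  · rintro ⟨_ | ⟨h, x⟩ | ⟨i, b₁, d⟩ | ⟨⟨α, p, p'⟩, hα, hp, hp'⟩, hb⟩
    · rcases hb with rfl | hb
      · exact .inl rfl
      · rw [Set.mem_iUnion] at hb
        obtain ⟨i, c, ⟨hc, hne⟩, rfl⟩ := hb
        exact .inr (.inl ⟨i, c, hc, hne, rfl⟩)
    · obtain ⟨y, rfl⟩ := hb
      exact .inr (.inr (.inl ⟨h, x, y, rfl⟩))
    · obtain ⟨b₂, rfl⟩ := hb
      exact .inr (.inr (.inr (.inl ⟨i, b₁, b₂, d, by omega, rfl⟩)))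
    · have hα' : α.val ≤ 12 * k + 8 := by omega
      have h3 := (hf α hα' p hp p' hp').1
      refine .inr (.inr (.inr (.inr ?_)))
      rcases hb with rfl | rfl | rfl
      exacts [⟨0, α, _, _, hα, hα', hp, hp', rfl⟩, ⟨1, α, _, _, hα, hα', hp', h3, rfl⟩,
        ⟨2, α, _, _, hα, hα', h3, hp, rfl⟩]
  · rintro (rfl | ⟨i, c, hc, hne, rfl⟩ | ⟨h, x, y, rfl⟩ | ⟨i, b₁, b₂, d, hd, rfl⟩ |
      ⟨i, α, p, p', hα, hα', hp, hp', rfl⟩)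
    · exact ⟨.inl (), .inl rfl⟩
    · exact ⟨.inl (), .inr (Set.mem_iUnion.2 ⟨i, c, ⟨hc, hne⟩, rfl⟩)⟩
    · exact ⟨.inr (.inl (h, x)), y, rfl⟩
    · exact ⟨.inr (.inr (.inl (i, b₁, ⟨d, by omega⟩))), b₂, rfl⟩
    · obtain ⟨h3, h4, h5⟩ := hf α hα' p hp p' hp'
      have hi : i = 0 ∨ i = 1 ∨ i = 2 := by clear * -; decide +revert
      rcases hi with rfl | rfl | rfl
      · exact ⟨.inr (.inr (.inr ⟨(⟨α, by omega⟩, p, p'), hα, hp, hp'⟩)), .inl rfl⟩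
      -- The triple `(p, p', f α p p')` is rotated so that `p` stands in copy 1 and `p'` in copy 2;
      -- the next case rotates once more.
      · refine ⟨.inr (.inr (.inr ⟨(⟨α, by omega⟩, f α p p', p), hα, h3, hp⟩)), .inr (.inl ?_)⟩
        dsimp only
        rw [h5]
      · refine ⟨.inr (.inr (.inr ⟨(⟨α, by omega⟩, p', f α p p'), hα, hp', h3⟩)), .inr (.inr ?_)⟩
        dsimp only
        rw [h4]
        rfl

theorem admitsOcycle_hananiBlocks (hP : IsPairSystem k P) (hB : IsSQS (12 * k + 14) B)
    (hO : AdmitsOcycle 1 B) (hA : oldA k ∈ B) : AdmitsOcycle 1 (hananiBlocks k B P) := by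
  classical
  obtain ⟨g, hg⟩ := isCircuit_copyPart hB hO hA
  have hex : ∀ α, ∃ f : Finset (ZMod (12 * k + 10)) → Finset (ZMod (12 * k + 10)) →
      Finset (ZMod (12 * k + 10)), α ≤ 12 * k + 8 → ∀ a ∈ P α, ∀ b ∈ P α,
        f a b ∈ P α ∧ f b (f a b) = a ∧ f (f a b) a = b := by
    intro α
    by_cases hα : α ≤ 12 * k + 8
    · obtain ⟨p, hp, -⟩ := hP.factor α hα 0
      obtain ⟨f, hf⟩ := exists_rotation_closed_op (Set.toFinite (P α)) ⟨p, hp.1⟩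
      exact ⟨f, fun _ => hf⟩
    · exact ⟨fun a _ => a, fun h => absurd h hα⟩
  choose f hf using hex
  let r : Finset (ZMod (12 * k + 10)) → ZMod (12 * k + 10) :=
    fun p => if h : p.Nonempty then h.choose else 0
  have hr : ∀ α ≤ 12 * k + 8, ∀ p ∈ P α, r p ∈ p := by
    intro α hα p hp
    have h := hP.nonempty hα hp
    simp only [r, dif_pos h]
    exact h.choose_spec
  have hcirc : ∀ j, IsCircuit (partBlocks B P f j) (partPoints g P f r j) := by
    rintro (_ | ⟨h, x⟩ | ⟨i, b₁, d⟩ | ⟨⟨α, p, p'⟩, hα, hp, hp'⟩)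
    · exact hg
    · exact isCircuit_mixed h x
    · exact isCircuit_spread i b₁ (by omega)
    · have hα' : α.val ≤ 12 * k + 8 := by omega
      exact isCircuit_triangle (hr α hα' p hp) (hr α hα' p' hp')
        (hr α hα' _ (hf α hα' p hp p' hp').1)
  have hconn : ∀ Q : Set (NewPt k), (∀ j, (partPoints g P f r j ∩ Q).Nonempty →
      partPoints g P f r j ⊆ Q) → partPoints g P f r (.inl ()) ⊆ Q →
      ∀ j, (partPoints g P f r j ∩ Q).Nonempty := by
    intro Q hQ hgQ
    have h0 : ∀ x, copyPt 0 x ∈ Q := fun x =>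
      hQ (.inr (.inl (g, x))) ⟨_, .inl rfl, hgQ rfl⟩ (.inr rfl)
    have htri : ∀ t, partPoints g P f r (.inr (.inr (.inr t))) ⊆ Q := fun t =>
      hQ (.inr (.inr (.inr t))) ⟨_, .inl rfl, h0 _⟩
    obtain ⟨p, ⟨hp, -⟩, -⟩ := hP.factor (4 * k + 2) (by omega) 0
    let t : {t : Fin (12 * k + 9) × Finset (ZMod (12 * k + 10)) × Finset (ZMod (12 * k + 10)) //
        4 * k + 2 ≤ t.1.val ∧ t.2.1 ∈ P t.1 ∧ t.2.2 ∈ P t.1} :=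
      ⟨(⟨4 * k + 2, by omega⟩, p, p), le_rfl, hp, hp⟩
    have hsome : ∀ i, ∃ x, copyPt i x ∈ Q := by
      intro i
      have hi : i = 0 ∨ i = 1 ∨ i = 2 := by clear * -; decide +revert
      rcases hi with rfl | rfl | rfl
      exacts [⟨0, h0 0⟩, ⟨_, htri t (.inr (.inl rfl))⟩, ⟨_, htri t (.inr (.inr rfl))⟩]
    -- The circuit of the fourth kind with `d = 0` and `b₁ = x - spreadOffset k i` passes through
    -- both points.
    have hstep : ∀ i x, copyPt i x ∈ Q → copyPt i (x + 1) ∈ Q := by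
      intro i x hx
      have := hQ (.inr (.inr (.inl (i, x - spreadOffset k i, 0))))
      simp only [partPoints, Fin.val_zero, Nat.cast_zero, sub_zero, add_zero, sub_add_cancel] at this
      exact this ⟨_, .inl rfl, hx⟩ (.inr rfl)
    have hall : ∀ i x, copyPt i x ∈ Q := by
      intro i x
      obtain ⟨y, hy⟩ := hsome i
      have : ∀ m : ℕ, copyPt (k := k) i (y + m) ∈ Q := by
        intro m
        induction m with
        | zero => simpa using hy
        | succ m ih =>
          rw [Nat.cast_succ, ← add_assoc]
          exact hstep i _ ih
      simpa using this (x - y).val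
    rintro (_ | ⟨h, x⟩ | ⟨i, b₁, d⟩ | t)
    · exact ⟨_, rfl, hgQ rfl⟩
    · exact ⟨_, .inr rfl, hall _ _⟩
    · exact ⟨_, .inl rfl, hall _ _⟩
    · exact ⟨_, .inl rfl, hall _ _⟩
  have := IsCircuit.iUnion (.inl ()) hcirc (pairwise_disjoint_partBlocks hP hf) hconn
  rw [iUnion_partBlocks hP hf] at this
  obtain ⟨W, v, -, h⟩ := this
  exact h.admitsOcycle ⟨_, .special⟩

lemma exists_relabelling {X : Type*} [Fintype X] {B : Set (Finset X)} {k : ℕ}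
    (hc : Fintype.card X = 12 * k + 14) {b : Finset X} (hb : b ∈ B) (h4 : b.card = 4) :
    ∃ e : X ≃ OldPt k, oldA k ∈ relabel e B := by
  classical
  have e₁ : {x // x ∈ b} ≃ Fin 4 := Fintype.equivFinOfCardEq (by simpa using h4)
  have e₂ : {x // ¬ x ∈ b} ≃ ZMod (12 * k + 10) := Fintype.equivOfCardEq (by
    rw [Fintype.card_subtype_compl, hc, ZMod.card, Fintype.card_coe, h4]
    omega)
  let e : X ≃ OldPt k :=
    (Equiv.sumCompl (· ∈ b)).symm.trans ((Equiv.sumComm _ _).trans (Equiv.sumCongr e₂ e₁))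
  refine ⟨e, b, hb, ?_⟩
  ext u
  rw [Finset.mem_map_equiv, mem_oldA]
  rcases u with x | h
  · simpa [e] using (e₂.symm x).2
  · simp [e]

end Parts

theorem mainTheorem4 {X : Type*} [Fintype X] [DecidableEq X] (n : ℕ) (hn : n ≡ 2 [MOD 12])
    (B : Set (Finset X)) (hB : IsSQS n B) (hO : AdmitsOcycle 1 B) :
    (∃ C : Set (Finset (Fin (3 * n - 8))), IsSQS (3 * n - 8) C ∧ AdmitsOcycle 1 C) ∧
    ∃ k : ℕ, n = 12 * k + 14 ∧
      (∃ e : X ≃ OldPt k, oldA k ∈ relabel e B) ∧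
      (∃ P, IsPairSystem k P) ∧
      ∀ (e : X ≃ OldPt k) (P : ℕ → Set (Finset (ZMod (12 * k + 10)))),
        oldA k ∈ relabel e B → IsPairSystem k P →
        IsSQS (3 * n - 8) (hananiBlocks k (relabel e B) P) ∧
        AdmitsOcycle 1 (hananiBlocks k (relabel e B) P) := by
  obtain ⟨b, hb⟩ : B.Nonempty := by
    obtain ⟨N, w, -, -, hw, -⟩ := hO
    exact ⟨_, hw.mapsTo (Set.mem_univ 0)⟩
  have h4 := hB.2.1 b hb
  have hle : 4 ≤ n := by
    rw [← h4, ← hB.1]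
    exact Finset.card_le_univ b
  -- A cycle is nonempty, so there is a block; hence `n ≥ 4`, which rules out `n = 2`.
  obtain ⟨k, rfl⟩ : ∃ k, n = 12 * k + 14 := by
    unfold Nat.ModEq at hn
    exact ⟨(n - 14) / 12, by omega⟩
  have key : ∀ (e : X ≃ OldPt k) (P : ℕ → Set (Finset (ZMod (12 * k + 10)))),
      oldA k ∈ relabel e B → IsPairSystem k P →
      IsSQS (3 * (12 * k + 14) - 8) (hananiBlocks k (relabel e B) P) ∧
      AdmitsOcycle 1 (hananiBlocks k (relabel e B) P) := fun e P hA hP =>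
    ⟨isSQS_hananiBlocks hP (hB.relabel e) hA,
      admitsOcycle_hananiBlocks hP (hB.relabel e) (hO.relabel e) hA⟩
  obtain ⟨e, he⟩ := exists_relabelling hB.1 hb h4
  obtain ⟨P, hP⟩ := exists_isPairSystem k
  obtain ⟨h1, h2⟩ := key e P he hP
  let e' : NewPt k ≃ Fin (3 * (12 * k + 14) - 8) := Fintype.equivFinOfCardEq h1.1
  exact ⟨⟨_, h1.relabel e', h2.relabel e'⟩, k, rfl, ⟨e, he⟩, ⟨P, hP⟩, key⟩
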